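/- **Model.** For even $n$, let $\Gamma$ be the random cubic multigraph on $\{1,\dots,n\}$ given by the configuration model: take $3n$ balls, three with each label $1,\dots,n$, choose a perfect matching of the balls uniformly at random, and for each matched pair of balls draw an edge between their labels (loops and multiple edges are allowed). Write $\mathbf P$ for the corresponding probability. Cycles are regarded as subgraphs; in a multigraph a loop is a cycle of length 1 and two parallel edges form a cycle of length 2. The intersection of two subgraphs consists of their common vertices and common edges. **Theorem.** (1) There is an absolute constant $M>0$ such that the following holds for every even $n$, every simple graph $K$ on $\{1,\dots,n\}$ (for instance the complete graph, or a cubic graph), all integers $r\ge 3$ and $s\le r$, and every real $\alpha\ge r$. Let $\mathcal C$ be the set of pairs $(C_1,C_2)$ of cycles of $K$, of lengths $r$ and $s$ respectively, such that $C_1\ne C_2$, $C_1\cap C_2\neq\emptyset$, and $C_1\cap C_2$ has at least two connected components. Then $$\sum_{(C_1,C_2)\in\mathcal C}\mathbf P(C_1\cup C_2\subseteq\Gamma)\;\le\; M\sum_{j=1}^{s}\ \sum_{p=2}^{s}\frac{(2\alpha^3)^{p-1}}{((p-1)!)^2}\; n^{\,r+s-p-j}\left(\frac 2n\right)^{r+s-j}.$$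 Here $C_1\cup C_2\subseteq\Gamma$ means that any two vertices joined by an edge of $C_1$ or of $C_2$ are joined by an edge of $\Gamma$; the indices $j$ and $p$ stand for the possible numbers of edges and of components of $C_1\cap C_2$. (2) For every $\varepsilon>0$, the probability that any two distinct cycles of $\Gamma$, both of length at most $(1-\varepsilon)\log_2 n$, have an intersection with at most one connected component tends to $1$ as $n\to\infty$ through the even integers. -/

import Mathlib

open Filter Topology

namespace CubicCycles

/-! ### Cycles and components in multigraphs -/

section Multigraph

variable {α β γ : Type*}

/-- `C` is a cycle of length `k ≥ 1`: it consists of `k` distinct vertices `v 0, …, v (k-1)` and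
`k` distinct edges `e 0, …, e (k-1)`, where `e i` joins `v i` to its cyclic successor.
(A loop is a cycle of length one, two parallel edges form a cycle of length two.) -/
def IsCycleOfLength (C : Graph α β) (k : ℕ) : Prop :=
  0 < k ∧ ∃ (v : Fin k → α) (e : Fin k → β),
    Function.Injective v ∧ Function.Injective e ∧
    C.vertexSet = Set.range v ∧
    ∀ (f : β) (x y : α),
      C.IsLink f x y ↔ ∃ i : Fin k, f = e i ∧ s(x, y) = s(v i, v (finRotate k i))

/-- The number of connected components of a multigraph (zero for the empty graph; here this is
only used for finite graphs). Loops and multiplicities of edges do not influence it. -/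
noncomputable def numComponents (G : Graph α β) : ℕ :=
  Nat.card G.toSimpleGraph.ConnectedComponent

/-- Every edge of `C` is present in `G`: vertices joined in `C` are joined in `G`. -/
def EdgesPresent (C : Graph α β) (G : Graph α γ) : Prop :=
  ∀ u v : α, C.Adj u v → G.Adj u v

instance finite_graph [Finite α] [Finite β] : Finite (Graph α β) := by
  refine Finite.of_injective
    (fun G : Graph α β => (G.vertexSet, G.IsLink)) ?_
  intro G H h
  simp only [Prod.mk.injEq] at h
  exact Graph.ext h.1 (fun e x y => by rw [h.2])

end Multigraph

/-! ### The configuration model of random cubic graphs -/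

/-- The ways to match up `3n` balls, three for each of the `n` labels, in pairs: a perfect matching
is given by the fixed-point free involution that sends each ball to its partner. -/
abbrev Pairing (n : ℕ) : Type :=
  {π : Equiv.Perm (Fin n × Fin 3) // ∀ x, π x ≠ x ∧ π (π x) = x}

/-- The cubic multigraph on `n` vertices of a pairing. Its edges are the pairs of the matching; a
pair joins the labels of its two balls. Loops and multiple edges are allowed. -/
def Pairing.graph {n : ℕ} (π : Pairing n) : Graph (Fin n) (Sym2 (Fin n × Fin 3)) where
  vertexSet := Set.univ
  IsLink e u v := ∃ x, e = s(x, π.1 x) ∧ x.1 = u ∧ (π.1 x).1 = v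
  isLink_symm := by
    intro e _
    refine ⟨?_⟩
    rintro u v ⟨x, rfl, hu, hv⟩
    refine ⟨π.1 x, ?_, hv, ?_⟩
    · rw [(π.2 x).2, Sym2.eq_swap]
    · rw [(π.2 x).2, hu]
  eq_or_eq_of_isLink_of_isLink := by
    rintro e u v u' v' ⟨x, rfl, hu, hv⟩ ⟨y, hxy, hu', hv'⟩
    rw [Sym2.eq_iff] at hxy
    rcases hxy with ⟨h, _⟩ | ⟨h, _⟩
    · left; rw [← hu, ← hu', h]
    · right; rw [← hu, ← hv', h]
  left_mem_of_isLink := by intros; trivial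

/-- The probability of an event for a uniformly random pairing on `n` labels. (There are pairings
exactly when `n` is even.) -/
noncomputable def prob {n : ℕ} (A : Set (Pairing n)) : ℝ :=
  (A.ncard : ℝ) / (Nat.card (Pairing n) : ℝ)

/-! ### Pairs of cycles meeting in at least two components -/

/-- The pairs `(C₁, C₂)` of cycles in the graph `K`, of lengths `r` and `s`, that are distinct and
intersect, and whose intersection has at least two components. -/
noncomputable def cyclePairs {n : ℕ} (K : SimpleGraph (Fin n)) (r s : ℕ) :
    Finset (Graph (Fin n) (Sym2 (Fin n)) × Graph (Fin n) (Sym2 (Fin n))) :=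
  (Set.toFinite {C : Graph (Fin n) (Sym2 (Fin n)) × Graph (Fin n) (Sym2 (Fin n)) |
    C.1 ≤ Graph.ofSimpleGraph K ∧ IsCycleOfLength C.1 r ∧
    C.2 ≤ Graph.ofSimpleGraph K ∧ IsCycleOfLength C.2 s ∧
    (C.1 ⊓ C.2).vertexSet.Nonempty ∧ C.1 ≠ C.2 ∧
    2 ≤ numComponents (C.1 ⊓ C.2)}).toFinset

/-- The event that any two distinct cycles of the random cubic multigraph, both of length at most
`L`, meet in at most one component. -/
def meetsAtMostOnce (n : ℕ) (L : ℝ) : Set (Pairing n) :=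
  {π | ∀ (C₁ C₂ : Graph (Fin n) (Sym2 (Fin n × Fin 3))) (k₁ k₂ : ℕ),
    C₁ ≤ π.graph → C₂ ≤ π.graph → IsCycleOfLength C₁ k₁ → IsCycleOfLength C₂ k₂ →
    (k₁ : ℝ) ≤ L → (k₂ : ℝ) ≤ L → C₁ ≠ C₂ → numComponents (C₁ ⊓ C₂) ≤ 1}

end CubicCycles

namespace CubicCycles

/-! Since a vertex has only three balls and a cycle uses two of them, two cycles of Γ through a
common vertex share a ball, hence an edge (`RootedCycle.shared_of_vertex_eq`). Along a traversal of
the second cycle, the intersection with the first is thus recorded by the set S ⊆ ZMod s of times at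
which a shared edge is followed; its maximal cyclic runs give the components. Only one direction is
needed: a single run makes the intersection connected, so a disconnected intersection of distinct
cycles gives p ≥ 2 runs (`exists_sharedPair`).

The sum in (1) is at most the expected number of pairs of distinct cycles of Γ with disconnected
intersection, because choosing one edge of Γ above each edge of K lifts pairs of cycles injectively
(`sum_prob_cyclePairs_le`). This expectation is bounded by a first-moment count. Root both
traversals at the beginning of a shared run, and let S have j elements and p runs. There are at most
binom(s-1, 2(p-1)) such S (`card_runSets_le`). Given S, the traversals are determined by v = r+s-p-j
distinct vertices with an ordered pair of balls at each, and by p-1 entry points among the 2r balls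
of the first cycle (`card_sharedPairs_le`). They prescribe E = v+p pairs of balls, which has
probability at most 1/∏_{i<E} (3n-2i-1) (`card_agree_mul_le`). The first v factors cancel against
the choice of vertices and balls up to (6/5)·2^v, and the other p have product at least (n/6)^p. So
each S contributes at most (6/5)·2^E·3^p·(2r)^(p-1)/n^p. The spare 3^p is absorbed by the gap
between 1/(2(p-1))! and 1/((p-1)!)² (`choose_mul_three_pow_le`), which gives M = 24.

For (2), the same count is applied directly to the cycles of Γ and summed over lengths up to ℓ =
⌊(1-ε) log₂ n⌋. For large n the terms with p = 2 dominate, and the total is O(ℓ^7·4^ℓ/n²) = O((log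
n)^7/n^(2ε)), which tends to 0. -/

/-! ### Counting pairings with prescribed pairs -/

/-- Conjugating a pairing by a transposition of two balls. -/
def Pairing.conjSwap {n : ℕ} (π : Pairing n) (y y' : Fin n × Fin 3) : Pairing n :=
  ⟨Equiv.swap y y' * π.1 * Equiv.swap y y', by
    intro x
    refine ⟨fun h => ?_, ?_⟩
    · refine (π.2 (Equiv.swap y y' x)).1 ?_
      have := congrArg (Equiv.swap y y') h
      simpa [Equiv.Perm.mul_apply] using this
    · simp [Equiv.Perm.mul_apply, (π.2 _).2]⟩

lemma Pairing.conjSwap_apply {n : ℕ} (π : Pairing n) (y y' x : Fin n × Fin 3) :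
    (π.conjSwap y y').1 x = Equiv.swap y y' (π.1 (Equiv.swap y y' x)) := rfl

lemma Pairing.conjSwap_injective {n : ℕ} (y y' : Fin n × Fin 3) :
    Function.Injective (fun π : Pairing n => π.conjSwap y y') := by
  intro π σ h
  apply Subtype.ext
  have h1 : Equiv.swap y y' * π.1 * Equiv.swap y y' = Equiv.swap y y' * σ.1 * Equiv.swap y y' :=
    congrArg Subtype.val h
  exact mul_left_cancel (mul_right_cancel h1)

/-- A switching argument: outside `D` all possible partners of `x` are equally likely. Conjugating
by the swap of `π₀.1 x` with any other admissible ball `y'` injects the pairings with partner `π₀.1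
x` into those with partner `y'`, and there are `3 * n - D.card - 1` choices of `y'`. -/
lemma card_agree_insert_le {n : ℕ} (π₀ : Pairing n) (D : Finset (Fin n × Fin 3))
    (hD : ∀ x ∈ D, π₀.1 x ∈ D) (x : Fin n × Fin 3) (hx : x ∉ D) :
    Nat.card {π : Pairing n // (∀ z ∈ D, π.1 z = π₀.1 z) ∧ π.1 x = π₀.1 x} * (3 * n - D.card - 1)
      ≤ Nat.card {π : Pairing n // ∀ z ∈ D, π.1 z = π₀.1 z} := by
  classical
  let T := {y : Fin n × Fin 3 // y ∉ insert x D}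
  have hmem : ∀ π : {π : Pairing n // ∀ z ∈ D, π.1 z = π₀.1 z}, π.1.1 x ∉ insert x D := by
    intro π h
    rcases Finset.mem_insert.1 h with h | h
    · exact (π.1.2 x).1 h
    · apply hx
      have h2 := π.2 _ h
      rw [(π.1.2 x).2] at h2
      rw [h2]
      exact hD _ h
  let f : {π : Pairing n // ∀ z ∈ D, π.1 z = π₀.1 z} → T := fun π => ⟨π.1.1 x, hmem π⟩
  rw [Nat.card_congr (Equiv.sigmaFiberEquiv f).symm, Nat.card_sigma]
  have hT : Fintype.card T = 3 * n - D.card - 1 := by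
    rw [Fintype.card_subtype_compl (fun y => y ∈ insert x D), Fintype.card_coe,
      Finset.card_insert_of_notMem hx]
    simp only [Fintype.card_prod, Fintype.card_fin]
    omega
  have key : ∀ y' : T, Nat.card {π : Pairing n // (∀ z ∈ D, π.1 z = π₀.1 z) ∧ π.1 x = π₀.1 x}
      ≤ Nat.card {q // f q = y'} := by
    intro y'
    have hy' := y'.2
    simp only [Finset.mem_insert, not_or] at hy'
    have hy := hmem ⟨π₀, fun _ _ => rfl⟩
    simp only [Finset.mem_insert, not_or] at hy
    have hsw : ∀ z ∈ D, Equiv.swap (π₀.1 x) y'.1 z = z := fun z hz =>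
      Equiv.swap_apply_of_ne_of_ne (fun h => hy.2 (h ▸ hz)) (fun h => hy'.2 (h ▸ hz))
    have hswx : Equiv.swap (π₀.1 x) y'.1 x = x :=
      Equiv.swap_apply_of_ne_of_ne (Ne.symm hy.1) (Ne.symm hy'.1)
    refine Nat.card_le_card_of_injective
      (fun π => ⟨⟨π.1.conjSwap (π₀.1 x) y'.1, fun z hz => ?_⟩, ?_⟩) ?_
    · rw [Pairing.conjSwap_apply, hsw z hz, π.2.1 z hz, hsw _ (hD z hz)]
    · apply Subtype.ext
      change (π.1.conjSwap (π₀.1 x) y'.1).1 x = y'.1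
      rw [Pairing.conjSwap_apply, hswx, π.2.2, Equiv.swap_apply_left]
    · intro π σ h
      have h1 := congrArg (fun q => q.1.1) h
      exact Subtype.ext (Pairing.conjSwap_injective _ _ h1)
  calc _ = ∑ _y : T, Nat.card {π : Pairing n //
        (∀ z ∈ D, π.1 z = π₀.1 z) ∧ π.1 x = π₀.1 x} := by
        rw [Finset.sum_const, Finset.card_univ, hT, smul_eq_mul, mul_comm]
    _ ≤ _ := Finset.sum_le_sum fun y _ => key y

/-- The number of pairings that agree with a given one on a union of `E` of its pairs. -/
lemma card_agree_mul_le {n : ℕ} (π₀ : Pairing n) (E : ℕ) (D : Finset (Fin n × Fin 3))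
    (hD : ∀ x ∈ D, π₀.1 x ∈ D) (hE : D.card = 2 * E) :
    Nat.card {π : Pairing n // ∀ z ∈ D, π.1 z = π₀.1 z} *
      ∏ i ∈ Finset.range E, (3 * n - 2 * i - 1) ≤ Nat.card (Pairing n) := by
  classical
  induction E generalizing D with
  | zero =>
    rw [Finset.prod_range_zero, mul_one]
    exact Finite.card_subtype_le (fun π : Pairing n => ∀ z ∈ D, π.1 z = π₀.1 z)
  | succ E ih =>
    obtain ⟨x, hx⟩ : D.Nonempty := by
      rw [← Finset.card_pos]; omega
    have hne := (π₀.2 x).1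
    let D' := (D.erase x).erase (π₀.1 x)
    have hc : D'.card = 2 * E := by
      have h1 : π₀.1 x ∈ D.erase x := Finset.mem_erase.2 ⟨hne, hD x hx⟩
      rw [Finset.card_erase_of_mem h1, Finset.card_erase_of_mem hx]
      omega
    have hinv : ∀ z ∈ D', π₀.1 z ∈ D' := by
      intro z hz
      simp only [D', Finset.mem_erase] at hz ⊢
      refine ⟨fun h => hz.2.1 (π₀.1.injective h), fun h => hz.1 ?_, hD z hz.2.2⟩
      rw [← h, (π₀.2 z).2]
    have hx' : x ∉ D' := by simp [D']
    have h1 := card_agree_insert_le π₀ D' hinv x hx'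
    have h2 := ih D' hinv hc
    have h3 : Nat.card {π : Pairing n // ∀ z ∈ D, π.1 z = π₀.1 z} ≤
        Nat.card {π : Pairing n // (∀ z ∈ D', π.1 z = π₀.1 z) ∧ π.1 x = π₀.1 x} := by
      refine Nat.card_le_card_of_injective (fun π => ⟨π.1, fun z hz => π.2 z ?_, π.2 x hx⟩) ?_
      · simp only [D', Finset.mem_erase] at hz
        exact hz.2.2
      · intro π σ h
        exact Subtype.ext (congrArg (fun q => q.1) h)
    rw [Finset.prod_range_succ]
    rw [hc] at h1
    calc _ = Nat.card {π : Pairing n // ∀ z ∈ D, π.1 z = π₀.1 z} * (3 * n - 2 * E - 1) *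
          ∏ i ∈ Finset.range E, (3 * n - 2 * i - 1) := by ring
      _ ≤ Nat.card {π : Pairing n // (∀ z ∈ D', π.1 z = π₀.1 z) ∧ π.1 x = π₀.1 x} *
          (3 * n - 2 * E - 1) * ∏ i ∈ Finset.range E, (3 * n - 2 * i - 1) := by gcongr
      _ ≤ _ := (Nat.mul_le_mul_right _ h1).trans h2

/-- There are pairings of the balls when the number of labels is even. -/
lemma card_pairing_pos (m : ℕ) : 0 < Nat.card (Pairing (2 * m)) := by
  have e : Fin (2 * m) × Fin 3 ≃ (Fin m × Fin 3) × Bool :=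
    Fintype.equivOfCardEq (by simp; ring)
  let f : Fin (2 * m) × Fin 3 → Fin (2 * m) × Fin 3 := fun x => e.symm ((e x).1, !(e x).2)
  have hf : Function.Involutive f := fun x => by simp [f]
  have : Nonempty (Pairing (2 * m)) := by
    refine ⟨⟨hf.toPerm, fun x => ⟨fun h => ?_, hf x⟩⟩⟩
    have h1 : f x = x := h
    have := congrArg (fun y => (e y).2) h1
    simp [f] at this
  exact Nat.card_pos

/-! ### Numerical estimates -/

lemma pow_self_le_three_pow_mul_factorial (p : ℕ) : p ^ p ≤ 3 ^ p * p.factorial := by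
  have h := Real.pow_div_factorial_le_exp (p : ℝ) (Nat.cast_nonneg p) p
  have h2 : Real.exp (p : ℝ) ≤ 3 ^ p := by
    have h3 : Real.exp (p : ℝ) = Real.exp 1 ^ p := by rw [← Real.exp_nat_mul, mul_one]
    rw [h3]
    exact pow_le_pow_left₀ (Real.exp_pos 1).le (by linarith [Real.exp_one_lt_d9]) p
  rw [div_le_iff₀ (by positivity)] at h
  have h4 : (p : ℝ) ^ p ≤ 3 ^ p * p.factorial :=
    h.trans (mul_le_mul_of_nonneg_right h2 (by positivity))
  exact_mod_cast h4

/-- Factor by factor, m(p-k) ≤ p(m-k), so the worst case is m = p, where p^p ≤ e^p·p! applies. -/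
lemma pow_le_three_pow_mul_descFactorial {m p : ℕ} (h : p ≤ m) :
    m ^ p ≤ 3 ^ p * m.descFactorial p := by
  have h1 : m ^ p * p.factorial ≤ p ^ p * m.descFactorial p := by
    rw [← Nat.descFactorial_self, Nat.descFactorial_eq_prod_range,
      Nat.descFactorial_eq_prod_range]
    rw [Finset.pow_eq_prod_const, Finset.pow_eq_prod_const, ← Finset.prod_mul_distrib,
      ← Finset.prod_mul_distrib]
    refine Finset.prod_le_prod' fun k hk => ?_
    have hk := Finset.mem_range.1 hk
    zify [hk.le, (hk.le.trans h)]
    have : (p : ℤ) ≤ m := by exact_mod_cast h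
    nlinarith
  have h2 := pow_self_le_three_pow_mul_factorial p
  refine Nat.le_of_mul_le_mul_right (c := p.factorial) ?_ (Nat.factorial_pos p)
  calc _ ≤ p ^ p * m.descFactorial p := h1
    _ ≤ 3 ^ p * p.factorial * m.descFactorial p := Nat.mul_le_mul_right _ h2
    _ = _ := by ring

/-- Each new vertex with its six ordered ball pairs is paid for by one edge, at a cost of a factor
2. For i ≥ 1 this is exact factor by factor; only i = 0 loses, by 6n/(2(3n-1)) ≤ 6/5. -/
lemma descFactorial_mul_six_pow_le {n v : ℕ} (hn : 2 ≤ n) (hv : v ≤ n) :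
    5 * (n.descFactorial v * 6 ^ v) ≤ 6 * 2 ^ v * ∏ i ∈ Finset.range v, (3 * n - 2 * i - 1) := by
  induction v with
  | zero => simp
  | succ v ih =>
    rw [Nat.descFactorial_succ, Finset.prod_range_succ]
    rcases Nat.eq_zero_or_pos v with rfl | hv0
    · simp; omega
    · have h := ih (by omega)
      have h2 : 6 * (n - v) ≤ 2 * (3 * n - 2 * v - 1) := by omega
      calc _ = 5 * (n.descFactorial v * 6 ^ v) * (6 * (n - v)) := by ring
        _ ≤ (6 * 2 ^ v * ∏ i ∈ Finset.range v, (3 * n - 2 * i - 1)) *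
            (2 * (3 * n - 2 * v - 1)) := Nat.mul_le_mul h h2
        _ = _ := by ring

/-- With n = 2m and v ≤ n, the factor of index k is at least 2m-2k-1 ≥ m-k, so the product dominates
a falling factorial of m even when v is close to n. -/
lemma pow_le_six_pow_mul_prod {n v p : ℕ} (hn : Even n) (hv : v ≤ n) (hp : 2 * p ≤ n) :
    n ^ p ≤ 6 ^ p * ∏ k ∈ Finset.range p, (3 * n - 2 * (v + k) - 1) := by
  obtain ⟨m, rfl⟩ := hn
  have h1 := pow_le_three_pow_mul_descFactorial (m := m) (p := p) (by omega)
  have h2 : m.descFactorial p ≤ ∏ k ∈ Finset.range p, (3 * (m + m) - 2 * (v + k) - 1) := by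
    rw [Nat.descFactorial_eq_prod_range]
    refine Finset.prod_le_prod' fun k hk => ?_
    have hk := Finset.mem_range.1 hk
    omega
  calc (m + m) ^ p = 2 ^ p * m ^ p := by rw [← two_mul, mul_pow]
    _ ≤ 2 ^ p * (3 ^ p * ∏ k ∈ Finset.range p, (3 * (m + m) - 2 * (v + k) - 1)) := by
      gcongr
      exact h1.trans (by gcongr)
    _ = _ := by rw [← mul_assoc, ← mul_pow]; norm_num

lemma descFactorial_mul_pow_le {n v p : ℕ} (hn : Even n) (hv : v ≤ n) (hp : 2 * p ≤ n)
    (hn2 : 2 ≤ n) :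
    5 * (n.descFactorial v * 6 ^ v * n ^ p) ≤
      6 * 2 ^ (v + p) * 3 ^ p * ∏ i ∈ Finset.range (v + p), (3 * n - 2 * i - 1) := by
  rw [Finset.prod_range_add]
  calc _ = 5 * (n.descFactorial v * 6 ^ v) * n ^ p := by ring
    _ ≤ _ := Nat.mul_le_mul (descFactorial_mul_six_pow_le hn2 hv) (pow_le_six_pow_mul_prod hn hv hp)
    _ = 6 * 2 ^ v * 6 ^ p * (∏ i ∈ Finset.range v, (3 * n - 2 * i - 1)) *
        ∏ k ∈ Finset.range p, (3 * n - 2 * (v + k) - 1) := by ring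
    _ = _ := by
      rw [show (6 : ℕ) ^ p = 2 ^ p * 3 ^ p by rw [← mul_pow]; norm_num]
      ring

/-- The central binomial coefficient is at least 4^k/(2k), so 1/(2k)! beats 1/(k!)² by a factor
4^k/(2k); this outweighs 3^k. -/
lemma choose_mul_three_pow_le (s k : ℕ) (hk : 0 < k) :
    (6 : ℝ) / 5 * 3 ^ (k + 1) * ((s - 1).choose (2 * k)) ≤
      24 * (s : ℝ) ^ (2 * k) / (k.factorial : ℝ) ^ 2 := by
  have h1 : ((s - 1).choose (2 * k) : ℝ) ≤ (s : ℝ) ^ (2 * k) / (2 * k).factorial := by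
    refine (Nat.choose_le_pow_div (2 * k) (s - 1)).trans ?_
    gcongr
    exact_mod_cast Nat.sub_le s 1
  have h2 : (4 : ℝ) ^ k * (k.factorial : ℝ) ^ 2 ≤ 2 * k * (2 * k).factorial := by
    have h3 := Nat.four_pow_le_two_mul_self_mul_centralBinom k hk
    have h4 : k.centralBinom * (k.factorial * k.factorial) = (2 * k).factorial := by
      have := Nat.choose_mul_factorial_mul_factorial (show k ≤ 2 * k by omega)
      rw [Nat.centralBinom_eq_two_mul_choose, ← this, show 2 * k - k = k by omega]
      ring
    have h5 : 4 ^ k * (k.factorial * k.factorial) ≤ 2 * k * (2 * k).factorial := by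
      rw [← h4, ← mul_assoc (2 * k)]
      exact Nat.mul_le_mul_right _ h3
    rw [sq]
    exact_mod_cast h5
  -- Bernoulli with 3/10 < 1/3: the exponential gain (4/3)^k absorbs the linear loss 2k, and
  -- produces the constant 24.
  have h6 : (3 : ℝ) * k ≤ 10 * (4 / 3) ^ k := by
    have := one_add_mul_le_pow (show (-2 : ℝ) ≤ 3 / 10 by norm_num) k
    have h7 : (1 + 3 / 10 : ℝ) ^ k ≤ (4 / 3) ^ k := pow_le_pow_left₀ (by norm_num) (by norm_num) k
    linarith
  have h8 : (3 : ℝ) ^ k * (4 / 3) ^ k = 4 ^ k := by rw [← mul_pow]; norm_num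
  have hf : (0 : ℝ) < (k.factorial : ℝ) ^ 2 := by positivity
  have hf2 : (0 : ℝ) < ((2 * k).factorial : ℝ) := by positivity
  calc (6 : ℝ) / 5 * 3 ^ (k + 1) * ((s - 1).choose (2 * k))
      ≤ 6 / 5 * 3 ^ (k + 1) * ((s : ℝ) ^ (2 * k) / (2 * k).factorial) := by gcongr
    _ = (s : ℝ) ^ (2 * k) * (18 / 5 * 3 ^ k / (2 * k).factorial) := by ring
    _ ≤ (s : ℝ) ^ (2 * k) * (24 / (k.factorial : ℝ) ^ 2) := by
      gcongr (s : ℝ) ^ (2 * k) * ?_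
      rw [div_le_div_iff₀ hf2 hf]
      have hA : (0 : ℝ) < 4 ^ k := by positivity
      refine le_of_mul_le_mul_left ?_ hA
      generalize ((2 * k).factorial : ℝ) = F at *
      calc (4 : ℝ) ^ k * (18 / 5 * 3 ^ k * (k.factorial : ℝ) ^ 2)
          = 18 / 5 * 3 ^ k * (4 ^ k * (k.factorial : ℝ) ^ 2) := by ring
        _ ≤ 18 / 5 * 3 ^ k * (2 * k * F) := by gcongr
        _ = 12 / 5 * 3 ^ k * F * (3 * k) := by ring
        _ ≤ 12 / 5 * 3 ^ k * F * (10 * (4 / 3) ^ k) :=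
          mul_le_mul_of_nonneg_left h6 (by positivity)
        _ = (3 ^ k * (4 / 3) ^ k) * (24 * F) := by ring
        _ = _ := by rw [h8]
    _ = _ := by ring

/-! ### Cyclic words with a given number of runs -/

section Runs

variable {s : ℕ}

/-- The first elements of the maximal runs of consecutive elements of `S`. -/
def runStarts (S : Finset (ZMod s)) : Finset (ZMod s) := S.filter (fun t => t - 1 ∉ S)

lemma card_runStarts_le (S : Finset (ZMod s)) : (runStarts S).card ≤ S.card :=
  Finset.card_filter_le _ _

lemma natCast_sub_one {t : ℕ} (ht : 1 ≤ t) : (t : ZMod s) - 1 = ((t - 1 : ℕ) : ZMod s) := by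
  rw [Nat.cast_sub ht, Nat.cast_one]

variable [NeZero s]

/-- The positive times below `s` at which membership in `S` changes. -/
def boundary (S : Finset (ZMod s)) : Finset ℕ :=
  (Finset.Icc 1 (s - 1)).filter (fun t => ¬ ((t : ZMod s) ∈ S ↔ (t : ZMod s) - 1 ∈ S))

lemma card_filter_sub_one_mem (P : ZMod s → Prop) [DecidablePred P] :
    (Finset.univ.filter (fun t : ZMod s => P (t - 1))).card =
      (Finset.univ.filter P).card := by
  refine Finset.card_bij (fun t _ => t - 1) (by simp) (by simp) ?_
  intro b hb
  exact ⟨b + 1, by simpa using hb, by simp⟩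

/-- Around the circle, exits from `S` and entries into `S` are equally many. -/
lemma card_runEnds (S : Finset (ZMod s)) :
    (Finset.univ.filter (fun t : ZMod s => t ∉ S ∧ t - 1 ∈ S)).card = (runStarts S).card := by
  have h1 := card_filter_sub_one_mem (fun t => t ∈ S)
  have h2 := Finset.card_filter_add_card_filter_not
    (s := Finset.univ.filter (fun t : ZMod s => t - 1 ∈ S)) (fun t => t ∈ S)
  have h3 := Finset.card_filter_add_card_filter_not
    (s := Finset.univ.filter (fun t : ZMod s => t ∈ S)) (fun t => t - 1 ∈ S)
  rw [Finset.filter_filter, Finset.filter_filter] at h2 h3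
  have e1 : (Finset.univ.filter (fun t : ZMod s => t - 1 ∈ S ∧ t ∈ S)) =
    (Finset.univ.filter (fun t : ZMod s => t ∈ S ∧ t - 1 ∈ S)) := by ext; simp [and_comm]
  have e2 : (Finset.univ.filter (fun t : ZMod s => t - 1 ∈ S ∧ t ∉ S)) =
    (Finset.univ.filter (fun t : ZMod s => t ∉ S ∧ t - 1 ∈ S)) := by ext; simp [and_comm]
  have e3 : (Finset.univ.filter (fun t : ZMod s => t ∈ S ∧ t - 1 ∉ S)) = runStarts S := by
    ext; simp [runStarts]
  rw [e1, e2] at h2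
  rw [e3] at h3
  omega

lemma card_runStarts_add_card_le (S : Finset (ZMod s)) : (runStarts S).card + S.card ≤ s := by
  rw [← card_runEnds]
  have h : (Finset.univ.filter (fun t : ZMod s => t ∉ S ∧ t - 1 ∈ S)) ⊆ Sᶜ := by
    intro t ht
    simp only [Finset.mem_filter, Finset.mem_univ, true_and] at ht
    simpa using ht.1
  have h2 := Finset.card_le_card h
  have h3 := Finset.card_compl_add_card S
  rw [ZMod.card] at h3
  omega

lemma card_filter_notMem_and_notMem (S : Finset (ZMod s)) :
    (Finset.univ.filter (fun t : ZMod s => t ∉ S ∧ t - 1 ∉ S)).card +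
      (runStarts S).card + S.card = s := by
  have h1 := Finset.card_filter_add_card_filter_not (s := Sᶜ) (fun t => t - 1 ∈ S)
  have e1 : Sᶜ.filter (fun t => t - 1 ∈ S) =
      Finset.univ.filter (fun t : ZMod s => t ∉ S ∧ t - 1 ∈ S) := by ext; simp
  have e2 : Sᶜ.filter (fun t => t - 1 ∉ S) =
      Finset.univ.filter (fun t : ZMod s => t ∉ S ∧ t - 1 ∉ S) := by ext; simp
  rw [e1, e2, card_runEnds] at h1
  have h3 := Finset.card_compl_add_card S
  rw [ZMod.card] at h3
  omega

/-- The changes are the p entries and p exits; the entry at time 0 is the only one not seen at a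
positive time, which leaves 2p-1. -/
lemma card_boundary (S : Finset (ZMod s)) (h0 : 0 ∈ S) (h1 : -1 ∉ S) :
    (boundary S).card + 1 = 2 * (runStarts S).card := by
  have hs : 0 < s := NeZero.pos s
  have hb : (boundary S).card = ((runStarts S).erase 0 ∪
      Finset.univ.filter (fun t : ZMod s => t ∉ S ∧ t - 1 ∈ S)).card := by
    refine Finset.card_bij (fun t _ => (t : ZMod s)) ?_ ?_ ?_
    · intro t ht
      simp only [boundary, Finset.mem_filter, Finset.mem_Icc] at ht
      have ht0 : (t : ZMod s) ≠ 0 := by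
        intro h
        rw [ZMod.natCast_eq_zero_iff] at h
        have := Nat.le_of_dvd (by omega) h
        omega
      simp only [runStarts, Finset.mem_union, Finset.mem_erase, Finset.mem_filter,
        Finset.mem_univ, true_and]
      tauto
    · intro t ht u hu h
      simp only [boundary, Finset.mem_filter, Finset.mem_Icc] at ht hu
      have := congrArg ZMod.val h
      rwa [ZMod.val_natCast_of_lt (by omega), ZMod.val_natCast_of_lt (by omega)] at this
    · intro t ht
      simp only [runStarts, Finset.mem_union, Finset.mem_erase, Finset.mem_filter,
        Finset.mem_univ, true_and] at ht
      have ht0 : t ≠ 0 := by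
        rintro rfl
        tauto
      refine ⟨t.val, ?_, ZMod.natCast_zmod_val t⟩
      simp only [boundary, Finset.mem_filter, Finset.mem_Icc, ZMod.natCast_zmod_val]
      have := ZMod.val_lt t
      have h3 : t.val ≠ 0 := by rwa [Ne, ZMod.val_eq_zero]
      refine ⟨by omega, by tauto⟩
  rw [hb, Finset.card_union_of_disjoint, card_runEnds, Finset.card_erase_of_mem]
  · have : 0 < (runStarts S).card := Finset.card_pos.2 ⟨0, by simp [runStarts, h0, h1]⟩
    omega
  · simp [runStarts, h0, h1]
  · rw [Finset.disjoint_left]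
    intro t ht hu
    simp only [runStarts, Finset.mem_erase, Finset.mem_filter, Finset.mem_univ, true_and] at ht hu
    tauto

/-- Before its last change `b`, `S` has the same changes as `T` and so agrees with it; from `b` on
it stays in its final state, outside `S`. -/
lemma subset_of_boundary_erase_eq {S T : Finset (ZMod s)} (hS0 : 0 ∈ S) (hS1 : -1 ∉ S)
    (hT0 : 0 ∈ T) {b c : ℕ} (hbS : b ∈ boundary S) (hb : ∀ t ∈ boundary S, t ≤ b)
    (hbc : b ≤ c) (h : (boundary S).erase b = (boundary T).erase c) : S ⊆ T := by
  have hs : 0 < s := NeZero.pos s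
  simp only [boundary, Finset.mem_filter, Finset.mem_Icc] at hbS
  have agree : ∀ t : ℕ, t < b → ((t : ZMod s) ∈ S ↔ (t : ZMod s) ∈ T) := by
    intro t
    induction t with
    | zero => intro _; simp [hS0, hT0]
    | succ t ih =>
      intro ht
      have h1 := ih (by omega)
      have h2 : t + 1 ∈ (boundary S).erase b ↔ t + 1 ∈ (boundary T).erase c := by rw [h]
      have h3 : t + 1 ≠ b := by omega
      have h4 : t + 1 ≠ c := by omega
      have h5 : 1 ≤ t + 1 ∧ t + 1 ≤ s - 1 := by omega
      simp only [boundary, Finset.mem_erase, Finset.mem_filter, Finset.mem_Icc, h3, h4, h5,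
        ne_eq, not_false_eq_true, true_and, and_self, natCast_sub_one (show 1 ≤ t + 1 by omega),
        Nat.add_sub_cancel] at h2
      tauto
  have tail : ∀ k : ℕ, b + k ≤ s - 1 → ((s - 1 - k : ℕ) : ZMod s) ∉ S := by
    intro k
    induction k with
    | zero =>
      intro _
      rw [Nat.sub_zero, Nat.cast_sub hs, ZMod.natCast_self, Nat.cast_one, zero_sub]
      exact hS1
    | succ k ih =>
      intro hk
      have h1 := ih (by omega)
      have h2 : s - 1 - k ∉ boundary S := fun hm => by
        have := hb _ hm
        omega
      have h5 : 1 ≤ s - 1 - k ∧ s - 1 - k ≤ s - 1 := by omega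
      simp only [boundary, Finset.mem_filter, Finset.mem_Icc, h5, and_self, true_and, not_not,
        natCast_sub_one (show 1 ≤ s - 1 - k by omega)] at h2
      rw [show s - 1 - (k + 1) = s - 1 - k - 1 by omega]
      tauto
  intro t ht
  have hlt := ZMod.val_lt t
  have htb : t.val < b := by
    by_contra hcon
    have := tail (s - 1 - t.val) (by omega)
    rw [show s - 1 - (s - 1 - t.val) = t.val by omega, ZMod.natCast_zmod_val] at this
    exact this ht
  have := (agree _ htb).1
  rw [ZMod.natCast_zmod_val] at this
  exact this ht

variable (s) in
/-- The cyclic words with `j` elements and `p` runs that start with a run and end with a gap. -/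
def runSets (j p : ℕ) : Finset (Finset (ZMod s)) :=
  Finset.univ.filter (fun S => 0 ∈ S ∧ -1 ∉ S ∧ S.card = j ∧ (runStarts S).card = p)

lemma mem_runSets {j p : ℕ} {S : Finset (ZMod s)} :
    S ∈ runSets s j p ↔ 0 ∈ S ∧ -1 ∉ S ∧ S.card = j ∧ (runStarts S).card = p := by
  simp [runSets]

/-- Of the 2p-1 changes, the last is redundant because the number of elements is prescribed.
Dropping it saves one power of s, which is what makes the bound (s²·2r)^(p-1) possible. -/
lemma card_runSets_le (j p : ℕ) : (runSets s j p).card ≤ (s - 1).choose (2 * (p - 1)) := by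
  have hs : 0 < s := NeZero.pos s
  have hcard : (Finset.powersetCard (2 * (p - 1)) (Finset.Icc 1 (s - 1))).card =
      (s - 1).choose (2 * (p - 1)) := by
    rw [Finset.card_powersetCard, Nat.card_Icc, Nat.add_sub_cancel]
  rw [← hcard]
  have hne : ∀ S ∈ runSets s j p, (boundary S).Nonempty := by
    intro S hS
    obtain ⟨h0, h1, -, -⟩ := mem_runSets.1 hS
    have h2 := card_boundary S h0 h1
    rw [← Finset.card_pos]
    omega
  refine Finset.card_le_card_of_injOn
    (fun S => (boundary S).erase (sSup (boundary S : Set ℕ))) ?_ ?_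
  · intro S hS
    obtain ⟨h0, h1, -, hp⟩ := mem_runSets.1 hS
    have h2 := card_boundary S h0 h1
    have h3 : sSup (boundary S : Set ℕ) ∈ boundary S :=
      Nat.sSup_mem (hne S hS) (boundary S).finite_toSet.bddAbove
    rw [Finset.mem_coe, Finset.mem_powersetCard]
    refine ⟨(Finset.erase_subset _ _).trans (Finset.filter_subset _ _), ?_⟩
    rw [Finset.card_erase_of_mem h3]
    omega
  · have main : ∀ S ∈ runSets s j p, ∀ T ∈ runSets s j p,
        sSup (boundary S : Set ℕ) ≤ sSup (boundary T : Set ℕ) →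
        (boundary S).erase (sSup (boundary S : Set ℕ)) =
          (boundary T).erase (sSup (boundary T : Set ℕ)) → S = T := by
      intro S hS T hT hle h
      obtain ⟨h0, h1, hj, -⟩ := mem_runSets.1 hS
      obtain ⟨h0', -, hj', -⟩ := mem_runSets.1 hT
      refine Finset.eq_of_subset_of_card_le (subset_of_boundary_erase_eq h0 h1 h0'
        (Nat.sSup_mem (hne S hS) (boundary S).finite_toSet.bddAbove) (fun t ht => ?_) hle h)
        (by rw [hj, hj'])
      exact le_csSup (boundary S).finite_toSet.bddAbove ht
    intro S hS T hT h
    rcases le_total (sSup (boundary S : Set ℕ)) (sSup (boundary T : Set ℕ)) with hle | hle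
    · exact main S hS T hT hle h
    · exact (main T hT S hS hle h.symm).symm

end Runs

/-! ### Rooted cycles of balls -/

/-- A closed traversal of a cycle of length `k` in the multigraph of `π`: at time `t` it enters a
vertex through the ball `Y t` and leaves it through the ball `X t`. -/
structure RootedCycle {n : ℕ} (π : Pairing n) (k : ℕ) (X Y : ZMod k → Fin n × Fin 3) : Prop where
  link : ∀ t, π.1 (X t) = Y (t + 1)
  vertex : ∀ t, (Y t).1 = (X t).1
  ne : ∀ t, X t ≠ Y t
  inj : Function.Injective (fun t => (X t).1)

/-- The balls used by a traversal. -/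
def balls {n k : ℕ} [NeZero k] (X Y : ZMod k → Fin n × Fin 3) : Finset (Fin n × Fin 3) :=
  Finset.univ.image X ∪ Finset.univ.image Y

lemma mem_balls {n k : ℕ} [NeZero k] {X Y : ZMod k → Fin n × Fin 3} {b : Fin n × Fin 3} :
    b ∈ balls X Y ↔ ∃ t, b = X t ∨ b = Y t := by
  simp only [balls, Finset.mem_union, Finset.mem_image, Finset.mem_univ, true_and]
  constructor
  · rintro (⟨t, rfl⟩ | ⟨t, rfl⟩)
    exacts [⟨t, Or.inl rfl⟩, ⟨t, Or.inr rfl⟩]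
  · rintro ⟨t, rfl | rfl⟩
    exacts [Or.inl ⟨t, rfl⟩, Or.inr ⟨t, rfl⟩]

namespace RootedCycle

variable {n k : ℕ} {π : Pairing n} {X Y : ZMod k → Fin n × Fin 3}

lemma link' (h : RootedCycle π k X Y) (t : ZMod k) : π.1 (Y t) = X (t - 1) := by
  have := h.link (t - 1)
  rw [sub_add_cancel] at this
  rw [← this, (π.2 _).2]

lemma X_injective (h : RootedCycle π k X Y) : Function.Injective X :=
  fun _ _ e => h.inj (congrArg Prod.fst e)

lemma Y_injective (h : RootedCycle π k X Y) : Function.Injective Y := by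
  intro t u e
  apply h.inj
  change (X t).1 = (X u).1
  rw [← h.vertex, ← h.vertex, e]

lemma X_ne_Y (h : RootedCycle π k X Y) (t u : ZMod k) : X t ≠ Y u := by
  intro e
  have : t = u := h.inj (by change (X t).1 = (X u).1; rw [e, h.vertex])
  exact h.ne t (by rw [e, this])

variable [NeZero k]

lemma X_mem (_h : RootedCycle π k X Y) (t : ZMod k) : X t ∈ balls X Y := mem_balls.2 ⟨t, Or.inl rfl⟩

lemma Y_mem (_h : RootedCycle π k X Y) (t : ZMod k) : Y t ∈ balls X Y := mem_balls.2 ⟨t, Or.inr rfl⟩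

lemma partner_mem (h : RootedCycle π k X Y) {b : Fin n × Fin 3} (hb : b ∈ balls X Y) :
    π.1 b ∈ balls X Y := by
  obtain ⟨t, rfl | rfl⟩ := mem_balls.1 hb
  · rw [h.link]; exact h.Y_mem _
  · rw [h.link']; exact h.X_mem _

lemma partner_mem_iff (h : RootedCycle π k X Y) {b : Fin n × Fin 3} :
    π.1 b ∈ balls X Y ↔ b ∈ balls X Y := by
  refine ⟨fun hb => ?_, h.partner_mem⟩
  have := h.partner_mem hb
  rwa [(π.2 b).2] at this

lemma eq_or_eq_of_mem (h : RootedCycle π k X Y) {b : Fin n × Fin 3} (hb : b ∈ balls X Y)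
    {t : ZMod k} (ht : b.1 = (X t).1) : b = X t ∨ b = Y t := by
  obtain ⟨u, rfl | rfl⟩ := mem_balls.1 hb
  · left; rw [h.inj ht]
  · right; rw [h.vertex] at ht; rw [h.inj ht]

lemma exists_vertex (h : RootedCycle π k X Y) {b : Fin n × Fin 3} (hb : b ∈ balls X Y) :
    ∃ t, b.1 = (X t).1 := by
  obtain ⟨t, rfl | rfl⟩ := mem_balls.1 hb
  exacts [⟨t, rfl⟩, ⟨t, h.vertex t⟩]

lemma card_balls (h : RootedCycle π k X Y) : (balls X Y).card = 2 * k := by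
  rw [balls, Finset.card_union_of_disjoint, Finset.card_image_of_injective _ h.X_injective,
    Finset.card_image_of_injective _ h.Y_injective, Finset.card_univ, ZMod.card, two_mul]
  rw [Finset.disjoint_left]
  intro b hb hb'
  simp only [Finset.mem_image, Finset.mem_univ, true_and] at hb hb'
  obtain ⟨t, rfl⟩ := hb
  obtain ⟨u, hu⟩ := hb'
  exact h.X_ne_Y t u hu.symm

/-- At a vertex of the cycle, the two balls of the cycle are determined by one another. -/
lemma other_unique (h : RootedCycle π k X Y) {a b c : Fin n × Fin 3} (ha : a ∈ balls X Y)
    (hb : b ∈ balls X Y) (hc : c ∈ balls X Y) (hac : a.1 = c.1) (hbc : b.1 = c.1)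
    (hne : a ≠ c) (hne' : b ≠ c) : a = b := by
  obtain ⟨t, ht⟩ := h.exists_vertex hc
  rcases h.eq_or_eq_of_mem ha (hac.trans ht) with h1 | h1 <;>
  rcases h.eq_or_eq_of_mem hb (hbc.trans ht) with h2 | h2 <;>
  rcases h.eq_or_eq_of_mem hc ht with h3 | h3 <;> simp_all

/-- At a vertex of the cycle, only one ball is not used. -/
lemma third_unique (h : RootedCycle π k X Y) {a b c : Fin n × Fin 3} (ha : a ∉ balls X Y)
    (hb : b ∉ balls X Y) (hc : c ∈ balls X Y) (hac : a.1 = c.1) (hbc : b.1 = c.1) : a = b := by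
  obtain ⟨t, ht⟩ := h.exists_vertex hc
  have key : ∀ x y z w : Fin 3, x ≠ y → z ≠ x → z ≠ y → w ≠ x → w ≠ y → z = w := by decide
  have ne_snd : ∀ {x y : Fin n × Fin 3}, x.1 = y.1 → x ≠ y → x.2 ≠ y.2 :=
    fun h1 h2 h3 => h2 (Prod.ext h1 h3)
  have h1 := h.vertex t
  refine Prod.ext (hac.trans hbc.symm) (key (X t).2 (Y t).2 a.2 b.2 ?_ ?_ ?_ ?_ ?_)
  · exact ne_snd h1.symm (h.ne t)
  · exact ne_snd (hac.trans ht) fun e => ha (e ▸ h.X_mem t)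
  · exact ne_snd ((hac.trans ht).trans h1.symm) fun e => ha (e ▸ h.Y_mem t)
  · exact ne_snd (hbc.trans ht) fun e => hb (e ▸ h.X_mem t)
  · exact ne_snd ((hbc.trans ht).trans h1.symm) fun e => hb (e ▸ h.Y_mem t)

/-- Two cycles through a common vertex share one of its balls. -/
lemma shared_of_vertex_eq {s : ℕ} {Z W : ZMod s → Fin n × Fin 3} (h : RootedCycle π k X Y)
    (h' : RootedCycle π s Z W) {t : ZMod s} {i : ZMod k} (hti : (X i).1 = (Z t).1) :
    Z t ∈ balls X Y ∨ W t ∈ balls X Y := by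
  by_contra! hcon
  exact h'.ne t (h.third_unique hcon.1 hcon.2 (h.X_mem i) hti.symm ((h'.vertex t).trans hti.symm))

end RootedCycle

/-! ### Pairs of rooted cycles with a given set of shared edges -/

/-- Two traversals of cycles that start in the same ball; `S` is the set of times at which the
second one follows an edge of the first. -/
structure SharedPair {n r s : ℕ} [NeZero r] (π : Pairing n) (S : Finset (ZMod s))
    (X Y : ZMod r → Fin n × Fin 3) (Z W : ZMod s → Fin n × Fin 3) : Prop where
  fst : RootedCycle π r X Y
  snd : RootedCycle π s Z W
  root : Z 0 = X 0
  shared : ∀ t, Z t ∈ balls X Y ↔ t ∈ S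

namespace SharedPair

variable {n r s : ℕ} [NeZero r] {π : Pairing n} {S : Finset (ZMod s)}
  {X Y : ZMod r → Fin n × Fin 3} {Z W : ZMod s → Fin n × Fin 3}

lemma shared' (h : SharedPair π S X Y Z W) (t : ZMod s) : W t ∈ balls X Y ↔ t - 1 ∈ S := by
  rw [← h.shared, ← h.fst.partner_mem_iff, h.snd.link']

lemma mem_of_vertex_eq (h : SharedPair π S X Y Z W) {t : ZMod s} {i : ZMod r}
    (hti : (X i).1 = (Z t).1) : t ∈ S ∨ t - 1 ∈ S := by
  rw [← h.shared, ← h.shared']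
  exact h.fst.shared_of_vertex_eq h.snd hti

/-- The balls that only the second traversal uses are the two ends of its unshared edges. -/
lemma card_union_balls [NeZero s] (h : SharedPair π S X Y Z W) :
    (balls X Y ∪ balls Z W).card = 2 * (r + (s - S.card)) := by
  have h1 : balls Z W \ balls X Y = Sᶜ.image Z ∪
      (Finset.univ.filter (fun t : ZMod s => t - 1 ∉ S)).image W := by
    ext b
    simp only [Finset.mem_sdiff, mem_balls (X := Z), Finset.mem_union, Finset.mem_image,
      Finset.mem_compl, Finset.mem_filter, Finset.mem_univ, true_and]
    constructor
    · rintro ⟨⟨t, rfl | rfl⟩, hb⟩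
      · exact Or.inl ⟨t, by rwa [← h.shared], rfl⟩
      · exact Or.inr ⟨t, by rwa [← h.shared'], rfl⟩
    · rintro (⟨t, ht, rfl⟩ | ⟨t, ht, rfl⟩)
      · exact ⟨⟨t, Or.inl rfl⟩, by rwa [h.shared]⟩
      · exact ⟨⟨t, Or.inr rfl⟩, by rwa [h.shared']⟩
  have h2 : Disjoint (Sᶜ.image Z)
      ((Finset.univ.filter (fun t : ZMod s => t - 1 ∉ S)).image W) := by
    rw [Finset.disjoint_left]
    intro b hb hb'
    simp only [Finset.mem_image] at hb hb'
    obtain ⟨t, -, rfl⟩ := hb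
    obtain ⟨u, -, hu⟩ := hb'
    exact h.snd.X_ne_Y t u hu.symm
  have h3 := card_filter_sub_one_mem (s := s) (fun t => t ∉ S)
  have h4 : Finset.univ.filter (fun t : ZMod s => t ∉ S) = Sᶜ := by ext; simp
  rw [← Finset.union_sdiff_self_eq_union, Finset.card_union_of_disjoint Finset.disjoint_sdiff,
    h.fst.card_balls, h1, Finset.card_union_of_disjoint h2,
    Finset.card_image_of_injective _ h.snd.X_injective,
    Finset.card_image_of_injective _ h.snd.Y_injective, h3, h4, Finset.card_compl, ZMod.card]
  ring

lemma agree (h : SharedPair π S X Y Z W) {π' : Pairing n} [NeZero s] {S' : Finset (ZMod s)}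
    (h' : SharedPair π' S' X Y Z W) :
    ∀ b ∈ balls X Y ∪ balls Z W, π'.1 b = π.1 b := by
  intro b hb
  rcases Finset.mem_union.1 hb with hb | hb <;> obtain ⟨t, rfl | rfl⟩ := mem_balls.1 hb
  · rw [h.fst.link, h'.fst.link]
  · rw [h.fst.link', h'.fst.link']
  · rw [h.snd.link, h'.snd.link]
  · rw [h.snd.link', h'.snd.link']

/-- The second traversal is determined by the first one, its new vertices, and the places
where it enters the first one. -/
lemma ext_snd [NeZero s] (h : SharedPair π S X Y Z W) {π' : Pairing n}
    {Z' W' : ZMod s → Fin n × Fin 3} (h' : SharedPair π' S X Y Z' W')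
    (hS : -1 ∉ S)
    (hnew : ∀ t, t ∉ S → t - 1 ∉ S → Z t = Z' t ∧ W t = W' t)
    (hstart : ∀ t, t ∈ S → t - 1 ∉ S → Z t = Z' t) : Z = Z' ∧ W = W' := by
  have main : ∀ t : ℕ, Z t = Z' t ∧ W t = W' t := by
    -- When the arriving edge is not shared, the vertex is either new, or an entry into the first
    -- cycle; there the arriving ball must be the one that the first cycle leaves free.
    have entering : ∀ t : ZMod s, t - 1 ∉ S → Z t = Z' t ∧ W t = W' t := by
      intro t h1
      by_cases ht : t ∈ S
      · have hz := hstart t ht h1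
        refine ⟨hz, h.fst.third_unique (c := Z t) (by rwa [h.shared']) (by rwa [h'.shared'])
          (by rwa [h.shared]) (h.snd.vertex t) ?_⟩
        rw [h'.snd.vertex t, hz]
      · exact hnew t ht h1
    intro t
    induction t with
    | zero => exact entering _ (by simpa using hS)
    | succ t ih =>
      have e : ((t + 1 : ℕ) : ZMod s) - 1 = t := by push_cast; ring
      -- After a shared edge nothing is left to choose: the arriving ball is dictated by the first
      -- cycle, and the departing ball is the first cycle's other ball (staying on it) or the free
      -- third ball (leaving it).
      by_cases h1 : ((t + 1 : ℕ) : ZMod s) - 1 ∈ S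
      · have hw : W ((t + 1 : ℕ) : ZMod s) = W' ((t + 1 : ℕ) : ZMod s) := by
          have h2 : Z (t : ZMod s) ∈ balls X Y := by rwa [h.shared, ← e]
          have h3 : π.1 (Z (t : ZMod s)) = π'.1 (Z (t : ZMod s)) := by
            obtain ⟨i, hi | hi⟩ := mem_balls.1 h2
            · rw [hi, h.fst.link, h'.fst.link]
            · rw [hi, h.fst.link', h'.fst.link']
          rw [h.snd.link, ih.1, h'.snd.link] at h3
          exact_mod_cast h3
        have hwm := (h.shared' _).2 h1
        refine ⟨?_, hw⟩
        by_cases ht : ((t + 1 : ℕ) : ZMod s) ∈ S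
        · refine h.fst.other_unique ((h.shared _).2 ht) ((h'.shared _).2 ht) hwm
            (h.snd.vertex _).symm ?_ (h.snd.ne _) ?_
          · rw [hw, h'.snd.vertex]
          · rw [hw]; exact h'.snd.ne _
        · refine h.fst.third_unique (fun hm => ht ((h.shared _).1 hm))
            (fun hm => ht ((h'.shared _).1 hm)) hwm (h.snd.vertex _).symm ?_
          rw [hw, h'.snd.vertex]
      · exact entering _ h1
  constructor <;> funext t
  · simpa using (main t.val).1
  · simpa using (main t.val).2

end SharedPair

/-- The ordered pairs of distinct balls at a vertex. -/
abbrev BallPair : Type := {x : Fin 3 × Fin 3 // x.1 ≠ x.2}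

lemma card_ballPair : Fintype.card BallPair = 6 := by decide

/-- The pairs of traversals that occur in some pairing with shared times `S`. -/
abbrev SharedPairs (n r : ℕ) {s : ℕ} [NeZero r] (S : Finset (ZMod s)) : Type :=
  {q : ((ZMod r → Fin n × Fin 3) × (ZMod r → Fin n × Fin 3)) ×
      ((ZMod s → Fin n × Fin 3) × (ZMod s → Fin n × Fin 3)) //
    ∃ π, SharedPair π S q.1.1 q.1.2 q.2.1 q.2.2}

/-- The code consists of the vertices of the first cycle and the vertices lying only on the second,
the two balls used at each, and the entry ball of every run other than the one at time 0, whose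
entry is the common root. -/
lemma card_sharedPairs_le {n r s j p : ℕ} [NeZero r] [NeZero s] {S : Finset (ZMod s)}
    (hS : S ∈ runSets s j p) :
    Nat.card (SharedPairs n r S) ≤
      n.descFactorial (r + (s - p - j)) * 6 ^ (r + (s - p - j)) * (2 * r) ^ (p - 1) := by
  classical
  obtain ⟨h0, h1, hj, hp⟩ := mem_runSets.1 hS
  let N := {t : ZMod s // t ∉ S ∧ t - 1 ∉ S}
  let T := {t : ZMod s // t ∈ (runStarts S).erase 0}
  have hN : Fintype.card (ZMod r ⊕ N) = r + (s - p - j) := by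
    have h2 := card_filter_notMem_and_notMem S
    rw [Fintype.card_sum, ZMod.card, Fintype.card_subtype]
    omega
  have hT : Fintype.card T = p - 1 := by
    rw [Fintype.card_coe, Finset.card_erase_of_mem, hp]
    simp [runStarts, h0, h1]
  have hcode : Nat.card ((ZMod r ⊕ N ↪ Fin n) × (ZMod r ⊕ N → BallPair) × (T → ZMod r × Bool)) =
      n.descFactorial (r + (s - p - j)) * 6 ^ (r + (s - p - j)) * (2 * r) ^ (p - 1) := by
    rw [Nat.card_eq_fintype_card, Fintype.card_prod, Fintype.card_prod, Fintype.card_embedding_eq,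
      Fintype.card_fun, Fintype.card_fun, hN, hT, card_ballPair, Fintype.card_fin,
      Fintype.card_prod, ZMod.card, Fintype.card_bool, mul_assoc, mul_comm r 2]
  rw [← hcode]
  choose π hπ using fun q : SharedPairs n r S => q.2
  have hT' : ∀ (q : SharedPairs n r S) (t : T), ∃ c : ZMod r × Bool,
      q.1.2.1 t.1 = if c.2 then q.1.1.1 c.1 else q.1.1.2 c.1 := by
    intro q t
    have ht := t.2
    simp only [runStarts, Finset.mem_erase, Finset.mem_filter] at ht
    obtain ⟨i, hi | hi⟩ := mem_balls.1 (((hπ q).shared t.1).2 ht.2.1)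
    · exact ⟨(i, true), by simpa using hi⟩
    · exact ⟨(i, false), by simpa using hi⟩
  choose c hc using hT'
  have hvert : ∀ q : SharedPairs n r S, Function.Injective
      (Sum.elim (fun i => (q.1.1.1 i).1) (fun t => (q.1.2.1 t.1).1) : ZMod r ⊕ N → Fin n) := by
    intro q
    refine Function.Injective.sumElim (hπ q).fst.inj
      ((hπ q).snd.inj.comp Subtype.val_injective) ?_
    intro i t e
    exact ((hπ q).mem_of_vertex_eq e).elim t.2.1 t.2.2
  have ne_snd : ∀ {x y : Fin n × Fin 3}, y.1 = x.1 → x ≠ y → x.2 ≠ y.2 :=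
    fun h1 h2 h3 => h2 (Prod.ext h1.symm h3)
  let code : SharedPairs n r S →
      (ZMod r ⊕ N ↪ Fin n) × (ZMod r ⊕ N → BallPair) × (T → ZMod r × Bool) := fun q =>
    (⟨_, hvert q⟩,
      Sum.elim
        (fun i => ⟨((q.1.1.1 i).2, (q.1.1.2 i).2),
          ne_snd ((hπ q).fst.vertex i) ((hπ q).fst.ne i)⟩)
        (fun t => ⟨((q.1.2.1 t.1).2, (q.1.2.2 t.1).2),
          ne_snd ((hπ q).snd.vertex t.1) ((hπ q).snd.ne t.1)⟩),
      c q)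
  refine Nat.card_le_card_of_injective code ?_
  intro q q' e
  have e1 : ∀ a : ZMod r ⊕ N, (Sum.elim (fun i => (q.1.1.1 i).1) (fun t => (q.1.2.1 t.1).1) a) =
      (Sum.elim (fun i => (q'.1.1.1 i).1) (fun t => (q'.1.2.1 t.1).1) a) := fun a =>
    DFunLike.congr_fun (congrArg Prod.fst e) a
  have e2 : ∀ a, (code q).2.1 a = (code q').2.1 a := fun a =>
    congrFun (congrArg (fun x => x.2.1) e) a
  have e3 : c q = c q' := congrArg (fun x => x.2.2) e
  have hX : q.1.1.1 = q'.1.1.1 := by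
    funext i
    exact Prod.ext (e1 (Sum.inl i)) (congrArg (fun x => x.1.1) (e2 (Sum.inl i)))
  have hY : q.1.1.2 = q'.1.1.2 := by
    funext i
    refine Prod.ext ?_ (congrArg (fun x => x.1.2) (e2 (Sum.inl i)))
    rw [(hπ q).fst.vertex, (hπ q').fst.vertex]
    exact e1 (Sum.inl i)
  have hq := hπ q
  have hq' := hπ q'
  rw [← hX, ← hY] at hq'
  have hZW := hq.ext_snd hq' h1 (fun t ht ht' => ?_) (fun t ht ht' => ?_)
  · exact Subtype.ext (Prod.ext (Prod.ext hX hY) (Prod.ext hZW.1 hZW.2))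
  · have a1 := e1 (Sum.inr ⟨t, ht, ht'⟩)
    have a2 := e2 (Sum.inr ⟨t, ht, ht'⟩)
    refine ⟨Prod.ext a1 (congrArg (fun x => x.1.1) a2), Prod.ext ?_ (congrArg (fun x => x.1.2) a2)⟩
    rw [(hπ q).snd.vertex, (hπ q').snd.vertex]
    exact a1
  · by_cases h : t = 0
    · rw [h, hq.root, hq'.root]
    · have htT : t ∈ (runStarts S).erase 0 := by
        simp [runStarts, h, ht, ht']
      have a1 := hc q ⟨t, htT⟩
      have a2 := hc q' ⟨t, htT⟩
      rw [a1, a2, e3, hX, hY]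

/-- The number of pairings together with a pair of traversals with shared times `S`. -/
lemma card_pairing_sharedPair_le {n r s j p : ℕ} [NeZero r] [NeZero s] {S : Finset (ZMod s)}
    (hS : S ∈ runSets s j p) (hn : Even n) :
    5 * Nat.card {q : Pairing n × (((ZMod r → Fin n × Fin 3) × (ZMod r → Fin n × Fin 3)) ×
        ((ZMod s → Fin n × Fin 3) × (ZMod s → Fin n × Fin 3))) //
          SharedPair q.1 S q.2.1.1 q.2.1.2 q.2.2.1 q.2.2.2} * n ^ p ≤
      6 * 2 ^ (r + (s - j)) * 3 ^ p * (2 * r) ^ (p - 1) * Nat.card (Pairing n) := by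
  classical
  obtain ⟨h0, h1, hj, hp⟩ := mem_runSets.1 hS
  set A := {q : Pairing n × (((ZMod r → Fin n × Fin 3) × (ZMod r → Fin n × Fin 3)) ×
        ((ZMod s → Fin n × Fin 3) × (ZMod s → Fin n × Fin 3))) //
          SharedPair q.1 S q.2.1.1 q.2.1.2 q.2.2.1 q.2.2.2} with hA
  -- An actual configuration forces the size relations that the numerical estimates and the
  -- truncated subtractions rely on: s ≤ n, 2E ≤ 3n, v ≤ n.
  rcases isEmpty_or_nonempty A with hemp | ⟨⟨q₀, hq₀⟩⟩
  · simp
  have hps := card_runStarts_add_card_le S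
  have hpj := card_runStarts_le S
  have hsn : s ≤ n := by
    have := Fintype.card_le_of_injective _ hq₀.snd.inj
    rwa [ZMod.card, Fintype.card_fin] at this
  have hp1 : 1 ≤ p := by
    rw [← hp]
    exact Finset.card_pos.2 ⟨0, by simp [runStarts, h0, h1]⟩
  have hcard := hq₀.card_union_balls
  set E := r + (s - j) with hE
  have hE3 : 2 * E ≤ 3 * n := by
    have := Finset.card_le_univ (balls q₀.2.1.1 q₀.2.1.2 ∪ balls q₀.2.2.1 q₀.2.2.2)
    rw [hcard, Fintype.card_prod, Fintype.card_fin, Fintype.card_fin, hj] at this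
    omega
  set v := r + (s - p - j) with hv
  have hvE : v + p = E := by omega
  let P := ∏ i ∈ Finset.range E, (3 * n - 2 * i - 1)
  have hP : 0 < P := by
    refine Finset.prod_pos fun i hi => ?_
    have := Finset.mem_range.1 hi
    omega
  let f : A → SharedPairs n r S := fun a => ⟨a.1.2, a.1.1, a.2⟩
  have hfib : ∀ q : SharedPairs n r S, Nat.card {a // f a = q} * P ≤ Nat.card (Pairing n) := by
    intro q
    obtain ⟨π₀, h⟩ := q.2
    refine le_trans (Nat.mul_le_mul_right _ ?_) (card_agree_mul_le π₀ E
      (balls q.1.1.1 q.1.1.2 ∪ balls q.1.2.1 q.1.2.2) ?_ (by rw [h.card_union_balls, hj]))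
    · refine Nat.card_le_card_of_injective (fun a => ⟨a.1.1.1, ?_⟩) ?_
      · have e : a.1.1.2 = q.1 := congrArg Subtype.val a.2
        have h2 := a.1.2
        rw [e] at h2
        exact h.agree h2
      · intro a b hab
        have e : a.1.1.2 = b.1.1.2 := (congrArg Subtype.val a.2).trans
          (congrArg Subtype.val b.2).symm
        exact Subtype.ext (Subtype.ext (Prod.ext (congrArg (fun x => x.1) hab) e))
    · intro b hb
      rcases Finset.mem_union.1 hb with hb | hb
      · exact Finset.mem_union_left _ (h.fst.partner_mem hb)
      · exact Finset.mem_union_right _ (h.snd.partner_mem hb)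
  have hAP : Nat.card A * P ≤ Nat.card (SharedPairs n r S) * Nat.card (Pairing n) := by
    rw [Nat.card_congr (Equiv.sigmaFiberEquiv f).symm, Nat.card_sigma, Finset.sum_mul]
    refine (Finset.sum_le_sum fun q _ => hfib q).trans ?_
    rw [Finset.sum_const, Finset.card_univ, smul_eq_mul, ← Nat.card_eq_fintype_card]
  -- Otherwise the falling factorial in the count of traversals vanishes, although `q₀` is one.
  have hv_le : v ≤ n := by
    by_contra hcon
    have h2 := card_sharedPairs_le (n := n) (r := r) hS
    rw [Nat.descFactorial_of_lt (by omega), zero_mul, zero_mul, Nat.le_zero,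
      Nat.card_eq_fintype_card, Fintype.card_eq_zero_iff] at h2
    exact h2.elim ⟨q₀.2, q₀.1, hq₀⟩
  have hnum := descFactorial_mul_pow_le (p := p) hn hv_le (by omega) (by omega)
  rw [hvE] at hnum
  refine Nat.le_of_mul_le_mul_right (c := P) ?_ hP
  calc 5 * Nat.card A * n ^ p * P = 5 * n ^ p * (Nat.card A * P) := by ring
    _ ≤ 5 * n ^ p * (n.descFactorial v * 6 ^ v * (2 * r) ^ (p - 1) * Nat.card (Pairing n)) := by
      refine Nat.mul_le_mul_left _ ?_
      exact hAP.trans (Nat.mul_le_mul_right _ (card_sharedPairs_le hS))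
    _ = 5 * (n.descFactorial v * 6 ^ v * n ^ p) * ((2 * r) ^ (p - 1) * Nat.card (Pairing n)) := by
      ring
    _ ≤ 6 * 2 ^ E * 3 ^ p * P * ((2 * r) ^ (p - 1) * Nat.card (Pairing n)) :=
      Nat.mul_le_mul_right _ hnum
    _ = _ := by ring

/-! ### Traversals of cycles in the multigraph of a pairing -/

/-- `C` consists of the edges of the multigraph of `π` given by the balls in `D`, and their ends. -/
structure SpannedBy {n : ℕ} (π : Pairing n) (C : Graph (Fin n) (Sym2 (Fin n × Fin 3)))
    (D : Finset (Fin n × Fin 3)) : Prop where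
  mem : ∀ v, v ∈ C.vertexSet ↔ ∃ b ∈ D, b.1 = v
  link : ∀ f x y, C.IsLink f x y ↔ ∃ b ∈ D, f = s(b, π.1 b) ∧ b.1 = x ∧ (π.1 b).1 = y

lemma SpannedBy.unique {n : ℕ} {π : Pairing n} {C C' : Graph (Fin n) (Sym2 (Fin n × Fin 3))}
    {D : Finset (Fin n × Fin 3)} (h : SpannedBy π C D) (h' : SpannedBy π C' D) : C = C' :=
  Graph.ext (Set.ext fun v => (h.mem v).trans (h'.mem v).symm)
    fun f x y => (h.link f x y).trans (h'.link f x y).symm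

lemma IsCycleOfLength.exists_zmod {α β : Type*} {C : Graph α β} {k : ℕ} (hC : IsCycleOfLength C k) :
    ∃ (v : ZMod k → α) (e : ZMod k → β), Function.Injective v ∧ Function.Injective e ∧
      C.vertexSet = Set.range v ∧
      ∀ f x y, C.IsLink f x y ↔ ∃ i : ZMod k, f = e i ∧ s(x, y) = s(v i, v (i + 1)) := by
  obtain ⟨hk, v, e, hv, he, hV, hL⟩ := hC
  obtain ⟨m, rfl⟩ : ∃ m, k = m + 1 := ⟨k - 1, by omega⟩
  refine ⟨v, e, hv, he, hV, fun f x y => ?_⟩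
  have h := hL f x y
  simp only [finRotate_apply] at h
  exact h

lemma exists_rootedCycle {n k : ℕ} [NeZero k] {π : Pairing n}
    {C : Graph (Fin n) (Sym2 (Fin n × Fin 3))} (hle : C ≤ π.graph) (hC : IsCycleOfLength C k) :
    ∃ X Y : ZMod k → Fin n × Fin 3, RootedCycle π k X Y ∧ SpannedBy π C (balls X Y) := by
  obtain ⟨v, e, hv, he, hV, hL⟩ := hC.exists_zmod
  have hX : ∀ i, ∃ x, e i = s(x, π.1 x) ∧ x.1 = v i ∧ (π.1 x).1 = v (i + 1) := by
    intro i
    have h1 : C.IsLink (e i) (v i) (v (i + 1)) := (hL _ _ _).2 ⟨i, rfl, rfl⟩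
    exact h1.mono hle
  choose X hXe hXv hXw using hX
  have hY : ∀ i, (π.1 (X (i - 1))).1 = v i := fun i => by rw [hXw, sub_add_cancel]
  have hR : RootedCycle π k X (fun t => π.1 (X (t - 1))) := by
    refine ⟨fun t => by rw [add_sub_cancel_right], fun t => ?_, fun t ht => ?_, fun t u htu => ?_⟩
    · rw [hY, hXv]
    -- Entering and leaving by the same ball would traverse the same edge twice in succession; for
    -- cycles of length one it would make the ball its own partner.
    · have h1 : e t = e (t - 1) := by
        rw [hXe t, hXe (t - 1), ht, (π.2 _).2, Sym2.eq_swap]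
      have h2 : t = t - 1 := he h1
      rw [← h2] at ht
      exact (π.2 (X t)).1 ht.symm
    · apply hv
      have : (X t).1 = (X u).1 := htu
      rwa [hXv, hXv] at this
  refine ⟨X, _, hR, fun w => ?_, fun f x y => ?_⟩
  · rw [hV]
    constructor
    · rintro ⟨i, rfl⟩
      exact ⟨X i, hR.X_mem i, hXv i⟩
    · rintro ⟨b, hb, rfl⟩
      obtain ⟨t, ht⟩ := hR.exists_vertex hb
      exact ⟨t, by rw [ht, hXv]⟩
  · rw [hL]
    constructor
    · rintro ⟨i, rfl, h⟩
      rw [Sym2.eq_iff] at h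
      rcases h with ⟨rfl, rfl⟩ | ⟨rfl, rfl⟩
      · exact ⟨X i, hR.X_mem i, hXe i, hXv i, hXw i⟩
      · refine ⟨π.1 (X i), hR.partner_mem (hR.X_mem i), ?_, hXw i, ?_⟩
        · rw [hXe i, (π.2 _).2, Sym2.eq_swap]
        · rw [(π.2 _).2, hXv]
    · rintro ⟨b, hb, rfl, rfl, rfl⟩
      obtain ⟨t, rfl | rfl⟩ := mem_balls.1 hb
      · refine ⟨t, (hXe t).symm, ?_⟩
        rw [hXv, hXw]
      · refine ⟨t - 1, ?_, ?_⟩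
        · rw [(π.2 _).2, Sym2.eq_swap]
          exact (hXe (t - 1)).symm
        · rw [(π.2 _).2, hXv, hXw, Sym2.eq_swap]

/-! ### Changing the root and the direction of a traversal -/

namespace RootedCycle

variable {n r s : ℕ} {π : Pairing n}
  {X Y : ZMod r → Fin n × Fin 3} {Z W : ZMod s → Fin n × Fin 3}

lemma shift (h : RootedCycle π r X Y) (a : ZMod r) :
    RootedCycle π r (fun t => X (t + a)) (fun t => Y (t + a)) where
  link t := by rw [h.link]; congr 1; ring
  vertex t := h.vertex _
  ne t := h.ne _
  inj t u e := add_right_cancel (h.inj e)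

variable [NeZero r] [NeZero s]

lemma balls_shift (X Y : ZMod r → Fin n × Fin 3) (a : ZMod r) :
    balls (fun t => X (t + a)) (fun t => Y (t + a)) = balls X Y := by
  ext b
  simp only [mem_balls]
  exact (Equiv.addRight a).exists_congr_left.trans (by simp)

/-- A departing ball is reached by rotation, an arriving ball by reversing the direction, which
exchanges the roles of `X` and `Y`. -/
lemma exists_root (h : RootedCycle π r X Y) {b : Fin n × Fin 3} (hb : b ∈ balls X Y) :
    ∃ X' Y', RootedCycle π r X' Y' ∧ X' 0 = b ∧ balls X' Y' = balls X Y := by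
  obtain ⟨a, rfl | rfl⟩ := mem_balls.1 hb
  · exact ⟨_, _, h.shift a, by rw [zero_add], balls_shift X Y a⟩
  · refine ⟨fun t => Y (a - t), fun t => X (a - t), ⟨fun t => ?_, fun t => (h.vertex _).symm,
      fun t => (h.ne _).symm, fun t u e => ?_⟩, by simp only [sub_zero], ?_⟩
    · rw [h.link']; congr 1; ring
    · have e' : (X (a - t)).1 = (X (a - u)).1 := by rw [← h.vertex, ← h.vertex]; exact e
      exact sub_right_injective (h.inj e')
    · ext b
      simp only [mem_balls]
      refine (Equiv.subLeft a).exists_congr_left.trans ?_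
      simp [or_comm]

/-- A cycle contained in another one is equal to it. -/
lemma balls_subset_of_subset (h : RootedCycle π r X Y) (h' : RootedCycle π s Z W)
    (hsub : ∀ t, Z t ∈ balls X Y) : balls X Y ⊆ balls Z W := by
  obtain ⟨X', Y', hX, h0, hb⟩ := h.exists_root (hsub 0)
  rw [← hb] at hsub ⊢
  -- From a common departing ball both traversals cross the same edge, and the next departing ball
  -- is the only other ball of the first cycle at the vertex reached.
  have main : ∀ t : ℕ, Z t = X' t := by
    intro t
    induction t with
    | zero => simp [h0]
    | succ t ih =>
      have hW : W ((t : ZMod s) + 1) = Y' ((t : ZMod r) + 1) := by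
        rw [← h'.link, ← hX.link, ih]
      push_cast
      refine hX.other_unique (hsub _) (hX.X_mem _) (hX.Y_mem ((t : ZMod r) + 1)) ?_
        (hX.vertex _).symm ?_ (hX.ne _)
      · rw [← hW, h'.vertex]
      · rw [← hW]; exact h'.ne _
  have hXm : ∀ i, X' i ∈ balls Z W := by
    intro i
    rw [← ZMod.natCast_zmod_val i, ← main]
    exact h'.X_mem _
  intro b hb
  obtain ⟨t, rfl | rfl⟩ := mem_balls.1 hb
  · exact hXm t
  · rw [← sub_add_cancel t 1, ← hX.link]
    exact h'.partner_mem (hXm _)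

end RootedCycle

/-- If the shared edges form a single run, then the intersection is connected. -/
lemma numComponents_inf_le_one {n r s : ℕ} [NeZero r] [NeZero s] {π : Pairing n}
    {X Y : ZMod r → Fin n × Fin 3} {Z W : ZMod s → Fin n × Fin 3} {S : Finset (ZMod s)}
    (h : SharedPair π S X Y Z W) {C₁ C₂ : Graph (Fin n) (Sym2 (Fin n × Fin 3))}
    (h₁ : SpannedBy π C₁ (balls X Y)) (h₂ : SpannedBy π C₂ (balls Z W))
    (hS : ∀ t ∈ S, t - 1 ∉ S → t = 0) : numComponents (C₁ ⊓ C₂) ≤ 1 := by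
  have h0V : (Z 0).1 ∈ (C₁ ⊓ C₂).vertexSet :=
    ⟨(h₁.mem _).2 ⟨_, h.fst.X_mem 0, by rw [h.root]⟩, (h₂.mem _).2 ⟨_, h.snd.X_mem 0, rfl⟩⟩
  have reach : ∀ t : ℕ, ((t : ZMod s) ∈ S ∨ (t : ZMod s) - 1 ∈ S) →
      ∀ hv : (Z t).1 ∈ (C₁ ⊓ C₂).vertexSet,
        (C₁ ⊓ C₂).toSimpleGraph.Reachable ⟨(Z 0).1, h0V⟩ ⟨(Z t).1, hv⟩ := by
    intro t
    induction t with
    | zero =>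
      intro _ hv
      have : (⟨(Z 0).1, h0V⟩ : (C₁ ⊓ C₂).vertexSet) = ⟨(Z ((0 : ℕ) : ZMod s)).1, hv⟩ := by simp
      rw [this]
    | succ t ih =>
      intro ht hv
      have e : ((t + 1 : ℕ) : ZMod s) - 1 = t := by push_cast; ring
      by_cases h1 : (t : ZMod s) ∈ S
      · have hm : Z t ∈ balls X Y := (h.shared _).2 h1
        have hw : (π.1 (Z (t : ZMod s))).1 = (Z ((t + 1 : ℕ) : ZMod s)).1 := by
          rw [h.snd.link, h.snd.vertex]; push_cast; rfl
        have hl : (C₁ ⊓ C₂).IsLink s(Z (t : ZMod s), π.1 (Z t)) (Z t).1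
            (Z ((t + 1 : ℕ) : ZMod s)).1 :=
          ⟨(h₁.link _ _ _).2 ⟨Z t, hm, rfl, rfl, hw⟩,
            (h₂.link _ _ _).2 ⟨Z t, h.snd.X_mem _, rfl, rfl, hw⟩⟩
        refine (ih (Or.inl h1) hl.left_mem).trans ?_
        by_cases heq : (⟨(Z t).1, hl.left_mem⟩ : (C₁ ⊓ C₂).vertexSet) =
            ⟨(Z ((t + 1 : ℕ) : ZMod s)).1, hv⟩
        · rw [heq]
        · exact SimpleGraph.Adj.reachable ⟨heq, ⟨_, hl⟩⟩
      · rw [e] at ht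
        have h2 := hS _ (ht.resolve_right h1) (by rwa [e])
        have : (⟨(Z 0).1, h0V⟩ : (C₁ ⊓ C₂).vertexSet) = ⟨(Z ((t + 1 : ℕ) : ZMod s)).1, hv⟩ := by
          simp only [h2]
        rw [this]
  have reach' : ∀ v : (C₁ ⊓ C₂).vertexSet,
      (C₁ ⊓ C₂).toSimpleGraph.Reachable ⟨(Z 0).1, h0V⟩ v := by
    rintro ⟨v, hv⟩
    obtain ⟨b, hb, hbv⟩ := (h₁.mem _).1 hv.1
    obtain ⟨c, hc, hcv⟩ := (h₂.mem _).1 hv.2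
    obtain ⟨i, hi⟩ := h.fst.exists_vertex hb
    obtain ⟨t, ht⟩ := h.snd.exists_vertex hc
    have hvt : v = (Z (t.val : ZMod s)).1 := by
      rw [ZMod.natCast_zmod_val, ← ht, hcv]
    subst hvt
    refine reach t.val ?_ hv
    rw [ZMod.natCast_zmod_val] at hbv ⊢
    exact h.mem_of_vertex_eq (hi.symm.trans hbv)
  have : Subsingleton (C₁ ⊓ C₂).toSimpleGraph.ConnectedComponent := by
    refine ⟨fun a b => ?_⟩
    induction a using SimpleGraph.ConnectedComponent.ind
    induction b using SimpleGraph.ConnectedComponent.ind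
    exact SimpleGraph.ConnectedComponent.sound ((reach' _).symm.trans (reach' _))
  exact Finite.card_le_one_iff_subsingleton.2 this

/-- Two distinct cycles whose intersection is disconnected are traversed by a pair of traversals
with at least two shared runs. -/
lemma exists_sharedPair {n r s : ℕ} [NeZero r] [NeZero s] {π : Pairing n}
    {C₁ C₂ : Graph (Fin n) (Sym2 (Fin n × Fin 3))} (hle₁ : C₁ ≤ π.graph) (hle₂ : C₂ ≤ π.graph)
    (hC₁ : IsCycleOfLength C₁ r) (hC₂ : IsCycleOfLength C₂ s) (hne : C₁ ≠ C₂)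
    (hcomp : 2 ≤ numComponents (C₁ ⊓ C₂)) :
    ∃ j ∈ Finset.Icc 1 s, ∃ p ∈ Finset.Icc 2 s, ∃ S ∈ runSets s j p,
      ∃ (X Y : ZMod r → Fin n × Fin 3) (Z W : ZMod s → Fin n × Fin 3),
      SharedPair π S X Y Z W ∧ SpannedBy π C₁ (balls X Y) ∧ SpannedBy π C₂ (balls Z W) := by
  classical
  obtain ⟨X₀, Y₀, hR₁, hS₁⟩ := exists_rootedCycle hle₁ hC₁
  obtain ⟨Z₀, W₀, hR₂, hS₂⟩ := exists_rootedCycle hle₂ hC₂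
  -- The start of a shared run serves as root. Without one, sharing propagates backwards around the
  -- circle, so all edges of the second cycle are shared and the cycles coincide, or none is and the
  -- intersection is empty.
  obtain ⟨a, ha, ha'⟩ : ∃ a, Z₀ a ∈ balls X₀ Y₀ ∧ Z₀ (a - 1) ∉ balls X₀ Y₀ := by
    by_contra! hcon
    have hdesc : ∀ a, Z₀ a ∈ balls X₀ Y₀ → ∀ t : ℕ, Z₀ (a - t) ∈ balls X₀ Y₀ := by
      intro a ha t
      induction t with
      | zero => simpa using ha
      | succ t ih =>
        have := hcon _ ih
        rwa [sub_sub, ← Nat.cast_succ] at this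
    have hall : ∀ a, Z₀ a ∈ balls X₀ Y₀ → ∀ b, Z₀ b ∈ balls X₀ Y₀ := by
      intro a ha b
      have := hdesc a ha (a - b).val
      rwa [ZMod.natCast_zmod_val, sub_sub_cancel] at this
    by_cases hex : ∃ a, Z₀ a ∈ balls X₀ Y₀
    · obtain ⟨a, ha⟩ := hex
      have hsub := hR₁.balls_subset_of_subset hR₂ (hall a ha)
      have hsub' : balls Z₀ W₀ ⊆ balls X₀ Y₀ := by
        intro b hb
        obtain ⟨t, rfl | rfl⟩ := mem_balls.1 hb
        · exact hall a ha t
        · rw [← sub_add_cancel t 1, ← hR₂.link]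
          exact hR₁.partner_mem (hall a ha _)
      rw [hsub'.antisymm hsub] at hS₂
      exact hne (hS₁.unique hS₂)
    · have hempty : IsEmpty (C₁ ⊓ C₂).vertexSet := by
        refine ⟨fun ⟨v, hv⟩ => ?_⟩
        obtain ⟨b, hb, hbv⟩ := (hS₁.mem _).1 hv.1
        obtain ⟨c, hc, hcv⟩ := (hS₂.mem _).1 hv.2
        obtain ⟨i, hi⟩ := hR₁.exists_vertex hb
        obtain ⟨t, ht⟩ := hR₂.exists_vertex hc
        rcases hR₁.shared_of_vertex_eq hR₂ (hi.symm.trans (hbv.trans (hcv.symm.trans ht))) with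
          h | h
        · exact hex ⟨t, h⟩
        · refine hex ⟨t - 1, ?_⟩
          rw [← hR₂.link']
          exact hR₁.partner_mem h
      have : IsEmpty (C₁ ⊓ C₂).toSimpleGraph.ConnectedComponent :=
        ⟨fun c => c.ind fun v => hempty.elim v⟩
      rw [numComponents, Nat.card_of_isEmpty] at hcomp
      omega
  obtain ⟨X, Y, hX, hX0, hb⟩ := hR₁.exists_root ha
  rw [← hb] at hS₁ ha ha'
  have hZ := hR₂.shift a
  rw [← RootedCycle.balls_shift Z₀ W₀ a] at hS₂
  let S : Finset (ZMod s) := Finset.univ.filter (fun t => Z₀ (t + a) ∈ balls X Y)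
  have h : SharedPair π S X Y (fun t => Z₀ (t + a)) (fun t => W₀ (t + a)) :=
    ⟨hX, hZ, by rw [hX0, zero_add], fun t => by simp [S]⟩
  have h0 : 0 ∈ S := by rwa [← h.shared, zero_add]
  have h1 : -1 ∉ S := by rwa [← h.shared, neg_add_eq_sub]
  have hrun : 2 ≤ (runStarts S).card := by
    by_contra hcon
    have h2 : (0 : ZMod s) ∈ runStarts S := by simp [runStarts, h0, h1]
    have h3 := numComponents_inf_le_one h hS₁ hS₂ fun t ht ht' =>
      Finset.card_le_one.1 (by omega) t (by simp [runStarts, ht, ht']) 0 h2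
    omega
  have h4 := card_runStarts_le S
  have h5 := card_runStarts_add_card_le S
  exact ⟨S.card, Finset.mem_Icc.2 ⟨by omega, by omega⟩, (runStarts S).card,
    Finset.mem_Icc.2 ⟨hrun, by omega⟩, S, mem_runSets.2 ⟨h0, h1, rfl, rfl⟩, X, Y, _, _, h, hS₁, hS₂⟩

/-! ### The expected number of pairs of cycles with disconnected intersection -/

lemma zpow_mul_two_div_zpow {n : ℕ} (hn : 0 < n) {r s j p : ℕ} (hj : j ≤ s) :
    (n : ℝ) ^ ((r : ℤ) + (s : ℤ) - (p : ℤ) - (j : ℤ)) *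
      (2 / (n : ℝ)) ^ ((r : ℤ) + (s : ℤ) - (j : ℤ)) = 2 ^ (r + (s - j)) / (n : ℝ) ^ p := by
  have hn' : (n : ℝ) ≠ 0 := by positivity
  have e1 : (r : ℤ) + (s : ℤ) - (j : ℤ) = ((r + (s - j) : ℕ) : ℤ) := by omega
  have e2 : (r : ℤ) + (s : ℤ) - (p : ℤ) - (j : ℤ) = ((r + (s - j) : ℕ) : ℤ) - (p : ℤ) := by omega
  rw [e1, e2, zpow_sub₀ hn', zpow_natCast, zpow_natCast, zpow_natCast, div_pow]
  field_simp

/-- The bound for the pairs of cycles of lengths `r` and `s`, up to a constant factor. -/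
noncomputable def pairBound (n r s : ℕ) (α : ℝ) : ℝ :=
  ∑ j ∈ Finset.Icc 1 s, ∑ p ∈ Finset.Icc 2 s,
    (2 * α ^ 3) ^ (p - 1) / ((Nat.factorial (p - 1) : ℝ) ^ 2)
      * (n : ℝ) ^ ((r : ℤ) + (s : ℤ) - (p : ℤ) - (j : ℤ))
      * (2 / (n : ℝ)) ^ ((r : ℤ) + (s : ℤ) - (j : ℤ))

/-- The pairings together with two distinct cycles of their multigraph, of lengths `r` and `s`,
whose intersection has at least two components. -/
def disconnectedPairs (n r s : ℕ) : Set (Pairing n ×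
    (Graph (Fin n) (Sym2 (Fin n × Fin 3)) × Graph (Fin n) (Sym2 (Fin n × Fin 3)))) :=
  {q | q.2.1 ≤ q.1.graph ∧ q.2.2 ≤ q.1.graph ∧ IsCycleOfLength q.2.1 r ∧
    IsCycleOfLength q.2.2 s ∧ q.2.1 ≠ q.2.2 ∧ 2 ≤ numComponents (q.2.1 ⊓ q.2.2)}

lemma sum_card_sharedPair_le {n r s j p : ℕ} [NeZero r] [NeZero s] {α : ℝ} (hn : Even n)
    (hr : (r : ℝ) ≤ α) (hs : s ≤ r) (hj : j ≤ s) (hp : 2 ≤ p) :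
    (∑ S ∈ runSets s j p, Nat.card {q : Pairing n × (((ZMod r → Fin n × Fin 3) ×
        (ZMod r → Fin n × Fin 3)) × ((ZMod s → Fin n × Fin 3) × (ZMod s → Fin n × Fin 3))) //
          SharedPair q.1 S q.2.1.1 q.2.1.2 q.2.2.1 q.2.2.2} : ℝ) ≤
      Nat.card (Pairing n) * (24 * ((2 * α ^ 3) ^ (p - 1) / ((Nat.factorial (p - 1) : ℝ) ^ 2)
        * (n : ℝ) ^ ((r : ℤ) + (s : ℤ) - (p : ℤ) - (j : ℤ))
        * (2 / (n : ℝ)) ^ ((r : ℤ) + (s : ℤ) - (j : ℤ)))) := by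
  have hα : 0 ≤ α := (Nat.cast_nonneg r).trans hr
  rcases Nat.eq_zero_or_pos n with rfl | hn0
  · rw [Finset.sum_eq_zero]
    · positivity
    · intro S _
      rw [Nat.cast_eq_zero, Nat.card_eq_zero]
      exact Or.inl ⟨fun q => (q.1.2.1.1 0).1.elim0⟩
  set k := p - 1 with hk
  have hpk : p = k + 1 := by omega
  set N : ℝ := ((Nat.card (Pairing n) : ℕ) : ℝ) with hN
  set D : ℝ := 6 / 5 * 2 ^ (r + (s - j)) * 3 ^ p * (2 * r) ^ k * N / (n : ℝ) ^ p with hD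
  have hnp : (0 : ℝ) < (n : ℝ) ^ p := by positivity
  have hone : ∀ S ∈ runSets s j p, (Nat.card {q : Pairing n × (((ZMod r → Fin n × Fin 3) ×
        (ZMod r → Fin n × Fin 3)) × ((ZMod s → Fin n × Fin 3) × (ZMod s → Fin n × Fin 3))) //
          SharedPair q.1 S q.2.1.1 q.2.1.2 q.2.2.1 q.2.2.2} : ℝ) ≤ D := by
    intro S hS
    have h := card_pairing_sharedPair_le (n := n) (r := r) hS hn
    rw [← Nat.cast_le (α := ℝ)] at h
    push_cast at h
    rw [hD, le_div_iff₀ hnp]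
    linarith
  rw [mul_assoc _ ((n : ℝ) ^ _), zpow_mul_two_div_zpow hn0 hj]
  have hD0 : 0 ≤ D := by positivity
  have hc := choose_mul_three_pow_le s k (by omega)
  have hsα : (s : ℝ) ≤ α := (Nat.cast_le.2 hs).trans hr
  calc _ ≤ ∑ _S ∈ runSets s j p, D := Finset.sum_le_sum hone
    _ = (runSets s j p).card * D := by rw [Finset.sum_const, nsmul_eq_mul]
    _ ≤ ((s - 1).choose (2 * k) : ℕ) * D := by
      gcongr
      exact card_runSets_le j p
    _ = (6 / 5 * 3 ^ (k + 1) * ((s - 1).choose (2 * k) : ℕ)) *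
        ((2 * r) ^ k * (N * (2 ^ (r + (s - j)) / (n : ℝ) ^ p))) := by
      rw [hD, ← hpk]; ring
    _ ≤ (24 * (s : ℝ) ^ (2 * k) / (k.factorial : ℝ) ^ 2) *
        ((2 * r) ^ k * (N * (2 ^ (r + (s - j)) / (n : ℝ) ^ p))) := by gcongr
    _ = 24 * ((s : ℝ) ^ 2 * (2 * r)) ^ k / (k.factorial : ℝ) ^ 2 *
        (N * (2 ^ (r + (s - j)) / (n : ℝ) ^ p)) := by
      rw [mul_pow ((s : ℝ) ^ 2) (2 * (r : ℝ)) k, ← pow_mul]; ring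
    _ ≤ 24 * (2 * α ^ 3) ^ k / (k.factorial : ℝ) ^ 2 *
        (N * (2 ^ (r + (s - j)) / (n : ℝ) ^ p)) := by
      have : (s : ℝ) ^ 2 * (2 * r) ≤ 2 * α ^ 3 := by
        calc (s : ℝ) ^ 2 * (2 * r) ≤ α ^ 2 * (2 * α) := by gcongr
          _ = _ := by ring
      gcongr
    _ = _ := by ring

/-- One traversal pair is chosen for each pair of cycles. The choice is injective because a pairing
and a set of balls determine the subgraph that they span. -/
lemma ncard_disconnectedPairs_le {n r s : ℕ} [NeZero r] [NeZero s] {α : ℝ} (hn : Even n)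
    (hr : (r : ℝ) ≤ α) (hs : s ≤ r) :
    ((disconnectedPairs n r s).ncard : ℝ) ≤
      Nat.card (Pairing n) * (24 * pairBound n r s α) := by
  classical
  let T : Finset (Pairing n × (((ZMod r → Fin n × Fin 3) × (ZMod r → Fin n × Fin 3)) ×
      ((ZMod s → Fin n × Fin 3) × (ZMod s → Fin n × Fin 3)))) :=
    (Finset.Icc 1 s).biUnion fun j => (Finset.Icc 2 s).biUnion fun p =>
      (runSets s j p).biUnion fun S => Finset.univ.filter fun q =>
        SharedPair q.1 S q.2.1.1 q.2.1.2 q.2.2.1 q.2.2.2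
  have hex : ∀ q : disconnectedPairs n r s, ∃ x ∈ T, x.1 = q.1.1 ∧
      SpannedBy q.1.1 q.1.2.1 (balls x.2.1.1 x.2.1.2) ∧
      SpannedBy q.1.1 q.1.2.2 (balls x.2.2.1 x.2.2.2) := by
    rintro ⟨q, h1, h2, h3, h4, h5, h6⟩
    obtain ⟨j, hj, p, hp, S, hS, X, Y, Z, W, h, hX, hZ⟩ := exists_sharedPair h1 h2 h3 h4 h5 h6
    refine ⟨(q.1, (X, Y), (Z, W)), ?_, rfl, hX, hZ⟩
    simp only [T, Finset.mem_biUnion, Finset.mem_filter, Finset.mem_univ, true_and]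
    exact ⟨j, hj, p, hp, S, hS, h⟩
  choose f hfT hf₁ hf₂ hf₃ using hex
  have hinj : Function.Injective (fun q => (⟨f q, hfT q⟩ : T)) := by
    intro q q' e
    have e : f q = f q' := congrArg Subtype.val e
    have e1 : q.1.1 = q'.1.1 := by rw [← hf₁ q, ← hf₁ q', e]
    have a1 := hf₂ q'
    have a2 := hf₃ q'
    rw [← e, ← e1] at a1 a2
    exact Subtype.ext (Prod.ext e1 (Prod.ext ((hf₂ q).unique a1) ((hf₃ q).unique a2)))
  have hcard : (disconnectedPairs n r s).ncard ≤ T.card := by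
    have := Nat.card_le_card_of_injective _ hinj
    rwa [Nat.card_coe_set_eq, Nat.card_eq_fintype_card, Fintype.card_coe] at this
  have hT : T.card ≤ ∑ j ∈ Finset.Icc 1 s, ∑ p ∈ Finset.Icc 2 s, ∑ S ∈ runSets s j p,
      Nat.card {q : Pairing n × (((ZMod r → Fin n × Fin 3) × (ZMod r → Fin n × Fin 3)) ×
        ((ZMod s → Fin n × Fin 3) × (ZMod s → Fin n × Fin 3))) //
          SharedPair q.1 S q.2.1.1 q.2.1.2 q.2.2.1 q.2.2.2} := by
    refine Finset.card_biUnion_le.trans (Finset.sum_le_sum fun j _ => ?_)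
    refine Finset.card_biUnion_le.trans (Finset.sum_le_sum fun p _ => ?_)
    refine Finset.card_biUnion_le.trans (Finset.sum_le_sum fun S _ => ?_)
    rw [Nat.card_eq_fintype_card, Fintype.card_subtype]
  calc ((disconnectedPairs n r s).ncard : ℝ) ≤ _ := Nat.cast_le.2 (hcard.trans hT)
    _ ≤ ∑ j ∈ Finset.Icc 1 s, ∑ p ∈ Finset.Icc 2 s, Nat.card (Pairing n) *
        (24 * ((2 * α ^ 3) ^ (p - 1) / ((Nat.factorial (p - 1) : ℝ) ^ 2)
        * (n : ℝ) ^ ((r : ℤ) + (s : ℤ) - (p : ℤ) - (j : ℤ))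
        * (2 / (n : ℝ)) ^ ((r : ℤ) + (s : ℤ) - (j : ℤ)))) := by
      push_cast
      refine Finset.sum_le_sum fun j hj => Finset.sum_le_sum fun p hp => ?_
      exact sum_card_sharedPair_le hn hr hs (Finset.mem_Icc.1 hj).2 (Finset.mem_Icc.1 hp).1
    _ = _ := by simp only [pairBound, Finset.mul_sum]

/-! ### Lifting cycles of a simple graph to the multigraph of a pairing -/

lemma numComponents_congr {α β γ : Type*} {G : Graph α β} {H : Graph α γ}
    (hV : G.vertexSet = H.vertexSet) (hA : ∀ u v, G.Adj u v ↔ H.Adj u v) :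
    numComponents G = numComponents H := by
  let φ : G.toSimpleGraph ≃g H.toSimpleGraph :=
    { toEquiv := Equiv.setCongr hV
      map_rel_iff' := by
        intro u v
        simp only [Graph.toSimpleGraph_adj, Equiv.setCongr_apply, ne_eq, hA, Subtype.ext_iff] }
  exact Nat.card_congr φ.connectedComponentEquiv

lemma exists_lift_edge {n : ℕ} (π : Pairing n) (e : Sym2 (Fin n)) :
    ∃ f : Sym2 (Fin n × Fin 3), ∀ u v, e = s(u, v) → π.graph.Adj u v → π.graph.IsLink f u v := by
  induction e with
  | h x y =>
    by_cases h : π.graph.Adj x y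
    · obtain ⟨f, hf⟩ := h
      refine ⟨f, fun u v huv _ => ?_⟩
      rw [hf.isLink_iff_sym2_eq]
      exact huv
    -- An arbitrary default value: the required property is vacuous when the ends are not joined in
    -- the multigraph.
    · refine ⟨s(((x, 0) : Fin n × Fin 3), (x, 0)), fun u v huv hadj => absurd ?_ h⟩
      rcases Sym2.eq_iff.1 huv with ⟨rfl, rfl⟩ | ⟨rfl, rfl⟩
      exacts [hadj, hadj.symm]

/-- A chosen edge of the multigraph of `π` above an edge of a simple graph. -/
noncomputable def liftEdge {n : ℕ} (π : Pairing n) (e : Sym2 (Fin n)) : Sym2 (Fin n × Fin 3) :=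
  (exists_lift_edge π e).choose

lemma isLink_liftEdge {n : ℕ} {π : Pairing n} {u v : Fin n} (h : π.graph.Adj u v) :
    π.graph.IsLink (liftEdge π s(u, v)) u v :=
  (exists_lift_edge π s(u, v)).choose_spec u v rfl h

/-- The subgraph of the multigraph of `π` formed by the chosen edges above the edges of `C`. -/
def liftGraph {n : ℕ} (π : Pairing n) (C : Graph (Fin n) (Sym2 (Fin n))) :
    Graph (Fin n) (Sym2 (Fin n × Fin 3)) where
  vertexSet := C.vertexSet
  IsLink f x y := C.IsLink s(x, y) x y ∧ f = liftEdge π s(x, y) ∧ π.graph.IsLink f x y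
  isLink_symm := by
    intro e _
    refine ⟨fun x y h => ⟨?_, ?_, h.2.2.symm⟩⟩
    · rw [Sym2.eq_swap]; exact h.1.symm
    · rw [Sym2.eq_swap]; exact h.2.1
  eq_or_eq_of_isLink_of_isLink _ _ _ _ _ h h' := h.2.2.left_eq_or_eq h'.2.2
  left_mem_of_isLink _ _ _ h := h.1.left_mem

section Lift

variable {n : ℕ} {π : Pairing n} {K : SimpleGraph (Fin n)} {C C' : Graph (Fin n) (Sym2 (Fin n))}

lemma liftGraph_le (π : Pairing n) (C : Graph (Fin n) (Sym2 (Fin n))) :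
    liftGraph π C ≤ π.graph :=
  ⟨Set.subset_univ _, fun _ _ _ h => h.2.2⟩

lemma edge_eq_of_le (hC : C ≤ Graph.ofSimpleGraph K) {e : Sym2 (Fin n)} {x y : Fin n}
    (h : C.IsLink e x y) : e = s(x, y) := (h.mono hC).1

lemma liftGraph_isLink_iff (hp : EdgesPresent C π.graph) {x y : Fin n} :
    (liftGraph π C).IsLink (liftEdge π s(x, y)) x y ↔ C.IsLink s(x, y) x y :=
  ⟨fun h => h.1, fun h => ⟨h, rfl, isLink_liftEdge (hp _ _ h.adj)⟩⟩

lemma isCycleOfLength_liftGraph (hC : C ≤ Graph.ofSimpleGraph K) (hp : EdgesPresent C π.graph)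
    {k : ℕ} (h : IsCycleOfLength C k) : IsCycleOfLength (liftGraph π C) k := by
  obtain ⟨hk, v, e, hv, he, hV, hL⟩ := h
  have hlink : ∀ i, C.IsLink (e i) (v i) (v (finRotate k i)) := fun i => (hL _ _ _).2 ⟨i, rfl, rfl⟩
  have hei : ∀ i, e i = s(v i, v (finRotate k i)) := fun i => edge_eq_of_le hC (hlink i)
  have hup : ∀ i, π.graph.IsLink (liftEdge π (e i)) (v i) (v (finRotate k i)) := fun i => by
    rw [hei i]; exact isLink_liftEdge (hp _ _ (hlink i).adj)
  refine ⟨hk, v, fun i => liftEdge π (e i), hv, fun i j hij => ?_, hV, fun f x y => ?_⟩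
  · have h1 := hup i
    have hij : liftEdge π (e i) = liftEdge π (e j) := hij
    rw [hij] at h1
    exact he (by rw [hei i, hei j]; exact h1.isLink_iff_sym2_eq.1 (hup j))
  · constructor
    · rintro ⟨h1, rfl, h3⟩
      obtain ⟨i, hi, hi'⟩ := (hL _ _ _).1 h1
      exact ⟨i, by rw [hi], hi'⟩
    · rintro ⟨i, rfl, hi⟩
      have h1 : C.IsLink (e i) x y := (hL _ _ _).2 ⟨i, rfl, hi⟩
      have h2 := edge_eq_of_le hC h1
      change (liftGraph π C).IsLink (liftEdge π (e i)) x y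
      rw [h2] at h1 ⊢
      exact (liftGraph_isLink_iff hp).2 h1

lemma liftGraph_injective (hC : C ≤ Graph.ofSimpleGraph K) (hC' : C' ≤ Graph.ofSimpleGraph K)
    (hp : EdgesPresent C π.graph) (hp' : EdgesPresent C' π.graph)
    (h : liftGraph π C = liftGraph π C') : C = C' := by
  have key : ∀ x y, C.IsLink s(x, y) x y ↔ C'.IsLink s(x, y) x y := fun x y => by
    rw [← liftGraph_isLink_iff hp, h, liftGraph_isLink_iff hp']
  have hV : (liftGraph π C).vertexSet = (liftGraph π C').vertexSet := by rw [h]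
  refine Graph.ext hV fun e x y => ⟨fun hl => ?_, fun hl => ?_⟩
  · have := edge_eq_of_le hC hl
    subst this
    exact (key x y).1 hl
  · have := edge_eq_of_le hC' hl
    subst this
    exact (key x y).2 hl

/-- The chosen edge depends only on its two ends and not on the cycle, so edges common to both
cycles lift to common edges and the intersections have the same adjacency. -/
lemma numComponents_liftGraph_inf (hC : C ≤ Graph.ofSimpleGraph K)
    (hp : EdgesPresent C π.graph) (hp' : EdgesPresent C' π.graph) :
    numComponents (liftGraph π C ⊓ liftGraph π C') = numComponents (C ⊓ C') := by
  refine numComponents_congr rfl fun u v => ⟨?_, ?_⟩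
  · rintro ⟨f, h1, h2⟩
    exact ⟨_, h1.1, h2.1⟩
  · rintro ⟨e, h1, h2⟩
    have := edge_eq_of_le hC h1
    subst this
    exact ⟨_, (liftGraph_isLink_iff hp).2 h1, (liftGraph_isLink_iff hp').2 h2⟩

end Lift

/-- Double counting: pairs of cycles of K together with a pairing containing both inject, by
lifting, into `disconnectedPairs`. -/
lemma sum_prob_cyclePairs_le {n : ℕ} (hn : Even n) (K : SimpleGraph (Fin n)) {r s : ℕ} {α : ℝ}
    (h3 : 3 ≤ r) (hr : (r : ℝ) ≤ α) (hs : s ≤ r) :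
    ∑ C ∈ cyclePairs K r s,
      prob {π : Pairing n | EdgesPresent C.1 π.graph ∧ EdgesPresent C.2 π.graph} ≤
      24 * pairBound n r s α := by
  classical
  have hmem : ∀ C, C ∈ cyclePairs K r s → C.1 ≤ Graph.ofSimpleGraph K ∧ IsCycleOfLength C.1 r ∧
      C.2 ≤ Graph.ofSimpleGraph K ∧ IsCycleOfLength C.2 s ∧ C.1 ≠ C.2 ∧
      2 ≤ numComponents (C.1 ⊓ C.2) := by
    intro C hC
    rw [cyclePairs, Set.Finite.mem_toFinset] at hC
    exact ⟨hC.1, hC.2.1, hC.2.2.1, hC.2.2.2.1, hC.2.2.2.2.2.1, hC.2.2.2.2.2.2⟩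
  have : NeZero r := ⟨by omega⟩
  rcases Nat.eq_zero_or_pos s with rfl | hs0
  · rw [Finset.sum_eq_zero]
    · simp [pairBound]
    · intro C hC
      exact absurd (hmem C hC).2.2.2.1.1 (lt_irrefl 0)
  have : NeZero s := ⟨by omega⟩
  have hN : (0 : ℝ) < Nat.card (Pairing n) := by
    obtain ⟨m, rfl⟩ := hn
    rw [← two_mul]
    exact_mod_cast card_pairing_pos m
  simp only [prob]
  rw [← Finset.sum_div, div_le_iff₀ hN, mul_comm]
  refine le_trans ?_ (ncard_disconnectedPairs_le hn hr hs)
  rw [← Nat.cast_sum, Nat.cast_le]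
  let F : Finset (Σ _ : Graph (Fin n) (Sym2 (Fin n)) × Graph (Fin n) (Sym2 (Fin n)), Pairing n) :=
    (cyclePairs K r s).sigma fun C => Finset.univ.filter fun π : Pairing n =>
      EdgesPresent C.1 π.graph ∧ EdgesPresent C.2 π.graph
  have hF : ∑ C ∈ cyclePairs K r s,
      {π : Pairing n | EdgesPresent C.1 π.graph ∧ EdgesPresent C.2 π.graph}.ncard = F.card := by
    rw [Finset.card_sigma]
    refine Finset.sum_congr rfl fun C _ => ?_
    rw [← Set.ncard_coe_finset]
    congr 1
    ext π
    simp
  rw [hF, ← Set.ncard_coe_finset]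
  refine Set.ncard_le_ncard_of_injOn
    (fun x => (x.2, liftGraph x.2 x.1.1, liftGraph x.2 x.1.2)) ?_ ?_ (Set.toFinite _)
  · rintro ⟨C, π⟩ hx
    simp only [F, Finset.coe_sigma, Set.mem_sigma_iff, Finset.mem_coe, Finset.mem_filter,
      Finset.mem_univ, true_and] at hx
    obtain ⟨hC, hp₁, hp₂⟩ := hx
    obtain ⟨h1, h2, h4, h5, h6, h7⟩ := hmem C hC
    refine ⟨liftGraph_le _ _, liftGraph_le _ _, isCycleOfLength_liftGraph h1 hp₁ h2,
      isCycleOfLength_liftGraph h4 hp₂ h5, fun e => h6 (liftGraph_injective h1 h4 hp₁ hp₂ e), ?_⟩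
    rwa [numComponents_liftGraph_inf h1 hp₁ hp₂]
  · rintro ⟨C, π⟩ hx ⟨C', π'⟩ hx' e
    simp only [F, Finset.coe_sigma, Set.mem_sigma_iff, Finset.mem_coe, Finset.mem_filter,
      Finset.mem_univ, true_and] at hx hx'
    obtain ⟨hC, hp₁, hp₂⟩ := hx
    obtain ⟨hC', hp₁', hp₂'⟩ := hx'
    simp only [Prod.mk.injEq] at e
    obtain ⟨rfl, e1, e2⟩ := e
    have c1 := liftGraph_injective (hmem C hC).1 (hmem C' hC').1 hp₁ hp₁' e1
    have c2 := liftGraph_injective (hmem C hC).2.2.1 (hmem C' hC').2.2.1 hp₂ hp₂' e2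
    rw [Prod.ext c1 c2]

/-! ### Short cycles meet at most once -/

lemma compl_meetsAtMostOnce_subset (n : ℕ) (L : ℝ) :
    (meetsAtMostOnce n L)ᶜ ⊆ ⋃ r ∈ Finset.Icc 1 ⌊L⌋₊, ⋃ s ∈ Finset.Icc 1 r,
      Prod.fst '' disconnectedPairs n r s := by
  intro π hπ
  simp only [meetsAtMostOnce, Set.mem_compl_iff, Set.mem_ofPred_eq, not_forall, not_le] at hπ
  obtain ⟨C₁, C₂, k₁, k₂, h1, h2, hc1, hc2, hk1, hk2, hne, hcomp⟩ := hπ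
  simp only [Set.mem_iUnion, Finset.mem_Icc]
  rcases le_total k₂ k₁ with h | h
  · exact ⟨k₁, ⟨hc1.1, Nat.le_floor hk1⟩, k₂, ⟨hc2.1, h⟩, (π, C₁, C₂),
      ⟨h1, h2, hc1, hc2, hne, hcomp⟩, rfl⟩
  · refine ⟨k₂, ⟨hc2.1, Nat.le_floor hk2⟩, k₁, ⟨hc1.1, h⟩, (π, C₂, C₁),
      ⟨h2, h1, hc2, hc1, hne.symm, ?_⟩, rfl⟩
    change 2 ≤ numComponents (C₂ ⊓ C₁)
    rwa [inf_comm]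

lemma ncard_compl_meetsAtMostOnce_le {n : ℕ} (hn : Even n) (L : ℝ) :
    ((meetsAtMostOnce n L)ᶜ.ncard : ℝ) ≤ Nat.card (Pairing n) *
      ∑ r ∈ Finset.Icc 1 ⌊L⌋₊, ∑ s ∈ Finset.Icc 1 r, 24 * pairBound n r s (⌊L⌋₊ : ℝ) := by
  have h1 : (meetsAtMostOnce n L)ᶜ.ncard ≤ ∑ r ∈ Finset.Icc 1 ⌊L⌋₊, ∑ s ∈ Finset.Icc 1 r,
      (disconnectedPairs n r s).ncard := by
    refine (Set.ncard_le_ncard (compl_meetsAtMostOnce_subset n L) (Set.toFinite _)).trans ?_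
    refine (Finset.set_ncard_biUnion_le _ _).trans (Finset.sum_le_sum fun r _ => ?_)
    refine (Finset.set_ncard_biUnion_le _ _).trans (Finset.sum_le_sum fun s _ => ?_)
    exact Set.ncard_image_le (Set.toFinite _)
  refine (Nat.cast_le.2 h1).trans ?_
  push_cast
  simp only [Finset.mul_sum (Finset.Icc 1 ⌊L⌋₊), Finset.mul_sum (Finset.Icc 1 _)]
  refine Finset.sum_le_sum fun r hr => Finset.sum_le_sum fun s hs => ?_
  rw [Finset.mem_Icc] at hr hs
  have : NeZero r := ⟨by omega⟩
  have : NeZero s := ⟨by omega⟩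
  exact ncard_disconnectedPairs_le hn (Nat.cast_le.2 hr.2) hs.2

/-- Each run beyond the second contributes a factor 2ℓ³/n ≤ 1, so every term is at most the bound
for p = 2, and there are at most ℓ² terms. -/
lemma pairBound_le {n r s l : ℕ} (hn : 0 < n) (hr : r ≤ l) (hs : s ≤ l)
    (hl : 2 * (l : ℝ) ^ 3 ≤ n) :
    pairBound n r s l ≤ l ^ 2 * (2 * (l : ℝ) ^ 3 * 4 ^ l / (n : ℝ) ^ 2) := by
  have hn' : (0 : ℝ) < n := by exact_mod_cast hn
  have hterm : ∀ j ∈ Finset.Icc 1 s, ∀ p ∈ Finset.Icc 2 s,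
      (2 * (l : ℝ) ^ 3) ^ (p - 1) / ((Nat.factorial (p - 1) : ℝ) ^ 2)
        * (n : ℝ) ^ ((r : ℤ) + (s : ℤ) - (p : ℤ) - (j : ℤ))
        * (2 / (n : ℝ)) ^ ((r : ℤ) + (s : ℤ) - (j : ℤ)) ≤
      2 * (l : ℝ) ^ 3 * 4 ^ l / (n : ℝ) ^ 2 := by
    intro j hj p hp
    rw [Finset.mem_Icc] at hj hp
    rw [mul_assoc, zpow_mul_two_div_zpow hn hj.2]
    obtain ⟨k, rfl⟩ : ∃ k, p = k + 2 := ⟨p - 2, by omega⟩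
    have h1 : (1 : ℝ) ≤ ((k + 2 - 1).factorial : ℝ) ^ 2 :=
      one_le_pow₀ (by exact_mod_cast Nat.factorial_pos _)
    have h2 : (2 : ℝ) ^ (r + (s - j)) ≤ 4 ^ l := by
      rw [show (4 : ℝ) = 2 ^ 2 by norm_num, ← pow_mul]
      exact pow_le_pow_right₀ (by norm_num) (by omega)
    calc _ ≤ (2 * (l : ℝ) ^ 3) ^ (k + 2 - 1) * (4 ^ l / (n : ℝ) ^ (k + 2)) := by
          gcongr
          exact div_le_self (by positivity) h1
      _ = (2 * (l : ℝ) ^ 3) ^ k * (2 * (l : ℝ) ^ 3) * (4 ^ l / (n : ℝ) ^ (k + 2)) := by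
          rw [show k + 2 - 1 = k + 1 by omega, pow_succ]
      _ ≤ (n : ℝ) ^ k * (2 * (l : ℝ) ^ 3) * (4 ^ l / (n : ℝ) ^ (k + 2)) := by gcongr
      _ = _ := by rw [pow_add]; field_simp
  have hnn : 0 ≤ 2 * (l : ℝ) ^ 3 * 4 ^ l / (n : ℝ) ^ 2 := by positivity
  calc pairBound n r s l ≤ ∑ _j ∈ Finset.Icc 1 s, ∑ _p ∈ Finset.Icc 2 s,
        2 * (l : ℝ) ^ 3 * 4 ^ l / (n : ℝ) ^ 2 :=
      Finset.sum_le_sum fun j hj => Finset.sum_le_sum fun p hp => hterm j hj p hp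
    _ = ((s * (s + 1 - 2) : ℕ) : ℝ) * (2 * (l : ℝ) ^ 3 * 4 ^ l / (n : ℝ) ^ 2) := by
      simp only [Finset.sum_const, Nat.card_Icc, nsmul_eq_mul]
      push_cast [Nat.add_sub_cancel]
      ring
    _ ≤ _ := by
      gcongr
      have : s * (s + 1 - 2) ≤ l ^ 2 := by
        rw [sq]
        exact Nat.mul_le_mul hs (by omega)
      exact_mod_cast this

lemma ncard_compl_meetsAtMostOnce_le' {n : ℕ} (hn : Even n) (hn0 : 0 < n) (L : ℝ)
    (hL : 2 * (⌊L⌋₊ : ℝ) ^ 3 ≤ n) :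
    ((meetsAtMostOnce n L)ᶜ.ncard : ℝ) ≤ Nat.card (Pairing n) *
      (48 * (⌊L⌋₊ : ℝ) ^ 7 * 4 ^ ⌊L⌋₊ / (n : ℝ) ^ 2) := by
  refine (ncard_compl_meetsAtMostOnce_le hn L).trans ?_
  gcongr
  set l := ⌊L⌋₊ with hl
  set B : ℝ := 24 * (l ^ 2 * (2 * (l : ℝ) ^ 3 * 4 ^ l / (n : ℝ) ^ 2)) with hB
  have hB0 : 0 ≤ B := by positivity
  calc _ ≤ ∑ _r ∈ Finset.Icc 1 l, ∑ _s ∈ Finset.Icc 1 l, B := by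
        refine Finset.sum_le_sum fun r hr => ?_
        rw [Finset.mem_Icc] at hr
        refine (Finset.sum_le_sum fun s hs => ?_).trans (Finset.sum_le_sum_of_subset_of_nonneg
          (Finset.Icc_subset_Icc_right hr.2) fun _ _ _ => hB0)
        rw [Finset.mem_Icc] at hs
        rw [hB]
        gcongr
        exact pairBound_le hn0 hr.2 (hs.2.trans hr.2) hL
    _ = _ := by
      simp only [Finset.sum_const, Nat.card_Icc, nsmul_eq_mul, Nat.add_sub_cancel]
      rw [hB]
      ring

lemma one_sub_le_prob_meetsAtMostOnce {ε : ℝ} (hε : 0 < ε) {m : ℕ} (hm : 0 < m)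
    (hlog : 2 * Real.logb 2 ((2 * m : ℕ) : ℝ) ^ 3 ≤ ((2 * m : ℕ) : ℝ)) :
    1 - 48 * (Real.logb 2 ((2 * m : ℕ) : ℝ) ^ 7 / ((2 * m : ℕ) : ℝ) ^ (2 * ε)) ≤
      prob (meetsAtMostOnce (2 * m) ((1 - ε) * Real.logb 2 ((2 * m : ℕ) : ℝ))) := by
  have hn0 : 0 < 2 * m := by omega
  set n := 2 * m with hn
  have hn1 : (1 : ℝ) ≤ n := by exact_mod_cast hn0
  have hlog0 : 0 ≤ Real.logb 2 (n : ℝ) := Real.logb_nonneg (by norm_num) hn1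
  set L := (1 - ε) * Real.logb 2 (n : ℝ) with hL
  have hLle : L ≤ Real.logb 2 (n : ℝ) := by nlinarith
  have hfl : (⌊L⌋₊ : ℝ) ≤ Real.logb 2 (n : ℝ) := by
    rcases le_total 0 L with h | h
    · exact (Nat.floor_le h).trans hLle
    · rw [Nat.floor_of_nonpos h]; simpa using hlog0
  have hN : (0 : ℝ) < Nat.card (Pairing n) := by exact_mod_cast card_pairing_pos m
  have h1 := ncard_compl_meetsAtMostOnce_le' (n := n) ⟨m, by omega⟩ hn0 L
    (le_trans (by gcongr) hlog)
  have h2 : (48 * (⌊L⌋₊ : ℝ) ^ 7 * 4 ^ ⌊L⌋₊ / (n : ℝ) ^ 2) ≤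
      48 * (Real.logb 2 (n : ℝ) ^ 7 / (n : ℝ) ^ (2 * ε)) := by
    -- For ε > 1 the number `L` can be negative, and then its floor does not lie below it; but a
    -- zero floor makes the left side vanish.
    rcases Nat.eq_zero_or_pos ⌊L⌋₊ with h | h
    · rw [h]
      simp only [Nat.cast_zero, ne_eq, OfNat.ofNat_ne_zero, not_false_eq_true, zero_pow, mul_zero,
        zero_mul, zero_div]
      positivity
    · have hL0 : 0 ≤ L := le_trans zero_le_one (Nat.floor_pos.1 h)
      have h4 : (4 : ℝ) ^ ⌊L⌋₊ ≤ (n : ℝ) ^ 2 / (n : ℝ) ^ (2 * ε) := by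
        have hnpos : (0 : ℝ) < n := by linarith
        calc (4 : ℝ) ^ ⌊L⌋₊ = (4 : ℝ) ^ (⌊L⌋₊ : ℝ) := (Real.rpow_natCast _ _).symm
          _ ≤ (4 : ℝ) ^ L := Real.rpow_le_rpow_of_exponent_le (by norm_num) (Nat.floor_le hL0)
          _ = ((2 : ℝ) ^ Real.logb 2 (n : ℝ)) ^ (2 - 2 * ε) := by
            rw [← Real.rpow_mul (by norm_num), show (4 : ℝ) = (2 : ℝ) ^ (2 : ℝ) by norm_num,
              ← Real.rpow_mul (by norm_num), hL]
            congr 1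
            ring
          _ = (n : ℝ) ^ (2 - 2 * ε) := by
            rw [Real.rpow_logb (by norm_num) (by norm_num) hnpos]
          _ = _ := by rw [Real.rpow_sub hnpos, Real.rpow_two]
      calc _ ≤ 48 * Real.logb 2 (n : ℝ) ^ 7 * ((n : ℝ) ^ 2 / (n : ℝ) ^ (2 * ε)) / (n : ℝ) ^ 2 := by
            gcongr
        _ = _ := by field_simp
  have h3 : (meetsAtMostOnce n L).ncard + (meetsAtMostOnce n L)ᶜ.ncard = Nat.card (Pairing n) :=
    Set.ncard_add_ncard_compl _
  have h3' : ((meetsAtMostOnce n L).ncard : ℝ) + (meetsAtMostOnce n L)ᶜ.ncard =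
      Nat.card (Pairing n) := by exact_mod_cast h3
  rw [prob, le_div_iff₀ hN]
  have h5 := mul_le_mul_of_nonneg_left h2 hN.le
  linarith

lemma prob_le_one {n : ℕ} (A : Set (Pairing n)) : prob A ≤ 1 := by
  refine div_le_one_of_le₀ ?_ (Nat.cast_nonneg _)
  exact_mod_cast Set.ncard_le_card A

lemma tendsto_prob_meetsAtMostOnce {ε : ℝ} (hε : 0 < ε) :
    Tendsto (fun m : ℕ => prob
      (meetsAtMostOnce (2 * m) ((1 - ε) * Real.logb 2 ((2 * m : ℕ) : ℝ)))) atTop (𝓝 1) := by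
  have hcast : Tendsto (fun m : ℕ => ((2 * m : ℕ) : ℝ)) atTop atTop :=
    tendsto_natCast_atTop_atTop.comp (tendsto_id.const_mul_atTop' (by norm_num))
  have hlog : ∀ (k : ℕ) {δ : ℝ}, 0 < δ →
      Tendsto (fun x : ℝ => Real.logb 2 x ^ k / x ^ δ) atTop (𝓝 0) := by
    intro k δ hδ
    have h := ((isLittleO_log_rpow_rpow_atTop (k : ℝ) hδ).tendsto_div_nhds_zero).const_mul
      ((Real.log 2 ^ k)⁻¹)
    rw [mul_zero] at h
    refine h.congr fun x => ?_
    rw [Real.rpow_natCast, Real.logb, div_pow]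
    ring
  have h1 : Tendsto (fun m : ℕ => 1 - 48 * (Real.logb 2 ((2 * m : ℕ) : ℝ) ^ 7 /
      ((2 * m : ℕ) : ℝ) ^ (2 * ε))) atTop (𝓝 1) := by
    have := (((hlog 7 (show 0 < 2 * ε by linarith)).comp hcast).const_mul 48).const_sub 1
    simpa using this
  have h2 : ∀ᶠ m : ℕ in atTop,
      2 * Real.logb 2 ((2 * m : ℕ) : ℝ) ^ 3 ≤ ((2 * m : ℕ) : ℝ) := by
    have := ((hlog 3 one_pos).comp hcast).eventually
      (gt_mem_nhds (show (0 : ℝ) < 1 / 2 by norm_num))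
    filter_upwards [this, eventually_gt_atTop 0] with m hm hm0
    have hpos : (0 : ℝ) < ((2 * m : ℕ) : ℝ) := by exact_mod_cast (by omega : 0 < 2 * m)
    simp only [Function.comp, Real.rpow_one] at hm
    rw [div_lt_iff₀ hpos] at hm
    linarith
  refine tendsto_of_tendsto_of_tendsto_of_le_of_le' h1 tendsto_const_nhds ?_
    (Eventually.of_forall fun m => prob_le_one _)
  filter_upwards [h2, eventually_gt_atTop 0] with m hm hm0
  exact one_sub_le_prob_meetsAtMostOnce hε hm0 hm

end CubicCycles

theorem mainTheorem5 :
    (∃ M : ℝ, 0 < M ∧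
      ∀ (n : ℕ), Even n → ∀ (K : SimpleGraph (Fin n)) (r s : ℕ) (α : ℝ),
        3 ≤ r → (r : ℝ) ≤ α → s ≤ r →
        ∑ C ∈ CubicCycles.cyclePairs K r s,
            CubicCycles.prob {π : CubicCycles.Pairing n |
              CubicCycles.EdgesPresent C.1 π.graph ∧ CubicCycles.EdgesPresent C.2 π.graph}
          ≤ M * ∑ j ∈ Finset.Icc 1 s, ∑ p ∈ Finset.Icc 2 s,
              (2 * α ^ 3) ^ (p - 1) / ((Nat.factorial (p - 1) : ℝ) ^ 2)
                * (n : ℝ) ^ ((r : ℤ) + (s : ℤ) - (p : ℤ) - (j : ℤ))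
                * (2 / (n : ℝ)) ^ ((r : ℤ) + (s : ℤ) - (j : ℤ))) ∧
    (∀ ε : ℝ, 0 < ε →
      Tendsto
        (fun m : ℕ => CubicCycles.prob
          (CubicCycles.meetsAtMostOnce (2 * m) ((1 - ε) * Real.logb 2 ((2 * m : ℕ) : ℝ))))
        atTop (𝓝 1)) := by
  refine ⟨⟨24, by norm_num, ?_⟩, ?_⟩
  · intro n hn K r s α h3 hr hs
    exact CubicCycles.sum_prob_cyclePairs_le hn K h3 hr hs
  · intro ε hε
    exact CubicCycles.tendsto_prob_meetsAtMostOnce hε
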